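/- Let $\Bbbk$ be a field and $\mathcal R=\Bbbk[t^{-1},t]]$ the field of Laurent series in $t$. A \emph{closed braid graph} $G$ is a planar oriented graph obtained from a closed braid diagram on $b\ge 1$ strands, with its outermost strand cut, by replacing each crossing either by a thick edge, at which two thin edges enter and two leave, or by its oriented resolution, with one bivalent vertex on each of the two strands; additional bivalent vertices may be placed on the strands, and every strand of the diagram is required to meet at least one thick edge or bivalent vertex. A thin edge runs from one thick edge, bivalent vertex or end of the cut strand to the next. A framing assigns an integer $\ell_i$ to each thin edge $i$. Let $\mathcal E(G)=\mathcal R[x_i]$ with one variable for each thin edge, and put $y_i=t^{-\ell_i}x_i$. Let $L(G)\subset\mathcal E(G)$ be the ideal generated by $(x_a+x_b)-(y_c+y_d)$ over all thick edges, where $a,b$ are the outgoing and $c,d$ the incoming thin edges. Let $N(G)$ be the ideal generated by $t^{\mathrm{wt}(\Gamma)}x_{\Gamma,\mathrm{out}}-y_{\Gamma,\mathrm{in}}$ over all sets $\Gamma$ of thick edges and bivalent vertices. Here $\mathrm{wt}(\Gamma)$ is the sum of the framings of the thin edges with both ends in $\Gamma$, $x_{\Gamma,\mathrm{out}}$ is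 the product of the $x_i$ over thin edges from $\Gamma$ to its complement, and $y_{\Gamma,\mathrm{in}}$ is the product of the $y_i$ over thin edges into $\Gamma$ from its complement (the ends of the cut strand lie in every complement). Let $V_G$ be the free $\mathcal E(G)$-module spanned by the connected components of $G$ other than the outermost one, which contains the cut strand and is designated special. Put $$\mathcal B(G)=\operatorname{Tor}^{\mathcal E(G)}_*\bigl(\mathcal E(G)/L(G),\,\mathcal E(G)/N(G)\bigr)\otimes_{\mathcal E(G)}\Lambda^*V_G .$$ The Ozsváth–Szabó knot Floer graph homology $\mathcal A(G)$, with ground ring $\mathcal R$, is the quotient of $\mathcal R[U_i]$, with one variable for each thin edge, by the relations - $t(U_a+U_b)=U_c+U_d$ and $t^2U_aU_b=U_cU_d$ at each thick edge with outgoing thin edges $a,b$ and incoming thin edges $c,d$; - $tU_a=U_c$ at each bivalent vertex with outgoing edge $a$ and incoming edge $c$; - $t^{w(W)}\prod_{i\in \mathrm{Out}(W)}U_i=\prod_{i\in \mathrm{In}(W)}U_i$ for each set $W$ of thick edges and bivalent vertices, where $w(W)$ is twice the number of thick edges plus the number of bivalent vertices in $W$, and $\mathrm{Out}(W)$, $\mathrm{In}(W)$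 are the sets of thin edges from $W$ to its complement and into $W$ from its complement. It is an $\mathcal E(G)$-module via $x_i\mapsto U_i$. **Proposition.** Let $G$ be a closed braid graph with its outermost connected component (containing the cut strand) designated special, and let $\mathtt e$ be the framing in which every thin edge is $+1$ framed. Then there is an isomorphism of $\mathcal E(G)$-modules $$\mathcal B(G^{\mathtt e})\cong\mathcal A(G),$$ which is graded when $\mathcal A(G)$ is placed in degree zero: it vanishes on $\operatorname{Tor}_i\otimes\Lambda^jV_G$ for all $(i,j)\neq(0,0)$. -/

import Mathlib

/-- The combinatorial data of an oriented trivalent graph with boundary.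

* `Edge` is the set of thin edges.
* `Node` is the set of interior nodes: a node is either a thick edge together with its two
  trivalent endpoints (two thin edges enter it and two leave it), or a bivalent vertex (one thin
  edge enters it and one leaves it).
* `src e = some v` says that the thin edge `e` starts at the node `v`; `src e = none` says that
  it starts at a univalent (boundary) vertex.  Likewise `tgt` for the end of `e`.

Everything defined below depends on the graph only through these incidences. -/
structure TrivalentGraph where
  Edge : Type
  Node : Type
  [fintypeEdge : Fintype Edge]
  [decEqEdge : DecidableEq Edge]
  [fintypeNode : Fintype Node]
  [decEqNode : DecidableEq Node]
  isThick : Node → Bool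
  src : Edge → Option Node
  tgt : Edge → Option Node
  card_out : ∀ v : Node,
    (Finset.univ.filter fun e : Edge => src e = some v).card = if isThick v then 2 else 1
  card_in : ∀ v : Node,
    (Finset.univ.filter fun e : Edge => tgt e = some v).card = if isThick v then 2 else 1

namespace TrivalentGraph

attribute [instance] fintypeEdge decEqEdge fintypeNode decEqNode

section Combinatorics

variable (G : TrivalentGraph)

/-- The thin edges leaving the node `v`. -/
def outEdges (v : G.Node) : Finset G.Edge := Finset.univ.filter fun e => G.src e = some v

/-- The thin edges entering the node `v`. -/
def inEdges (v : G.Node) : Finset G.Edge := Finset.univ.filter fun e => G.tgt e = some v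

/-- The edge `e` starts in the set of nodes `Γ`. -/
def StartsIn (Γ : Finset G.Node) (e : G.Edge) : Prop := ∃ v ∈ Γ, G.src e = some v

/-- The edge `e` ends in the set of nodes `Γ`. -/
def EndsIn (Γ : Finset G.Node) (e : G.Edge) : Prop := ∃ v ∈ Γ, G.tgt e = some v

instance (Γ : Finset G.Node) : DecidablePred (G.StartsIn Γ) :=
  fun e => inferInstanceAs (Decidable (∃ v ∈ Γ, G.src e = some v))

instance (Γ : Finset G.Node) : DecidablePred (G.EndsIn Γ) :=
  fun e => inferInstanceAs (Decidable (∃ v ∈ Γ, G.tgt e = some v))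

/-- The thin edges internal to `Γ`: both endpoints are at nodes of `Γ`. -/
def internalEdges (Γ : Finset G.Node) : Finset G.Edge :=
  Finset.univ.filter fun e => G.StartsIn Γ e ∧ G.EndsIn Γ e

/-- The thin edges from `Γ` to its complement (boundary vertices lie in the complement). -/
def setOut (Γ : Finset G.Node) : Finset G.Edge :=
  Finset.univ.filter fun e => G.StartsIn Γ e ∧ ¬ G.EndsIn Γ e

/-- The thin edges into `Γ` from its complement (boundary vertices lie in the complement). -/
def setIn (Γ : Finset G.Node) : Finset G.Edge :=
  Finset.univ.filter fun e => ¬ G.StartsIn Γ e ∧ G.EndsIn Γ e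

/-- Two thin edges are adjacent if they have an endpoint at a common node. -/
def AdjEdges (e f : G.Edge) : Prop :=
  ∃ v : G.Node, (G.src e = some v ∨ G.tgt e = some v) ∧ (G.src f = some v ∨ G.tgt f = some v)

/-- The connected components of the graph, as classes of thin edges.  (Every node has incident
thin edges, so every connected component contains a thin edge.) -/
def Component : Type := Quot G.AdjEdges

/-- The connected component containing a given thin edge. -/
def componentOf (e : G.Edge) : G.Component := Quot.mk _ e

end Combinatorics

noncomputable section Algebra

variable (G : TrivalentGraph) (𝕜 : Type*) [Field 𝕜]

/-- The monomial `t ^ ℓ` in the field of Laurent series in `t` over `𝕜`. -/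
def tpow (ℓ : ℤ) : LaurentSeries 𝕜 := HahnSeries.single ℓ 1

/-- The polynomial ring over Laurent series with two variables per thin edge `e`: `x e` for its
first segment and `y e` for its second segment. -/
abbrev MarkedRing : Type _ := MvPolynomial (G.Edge ⊕ G.Edge) (LaurentSeries 𝕜)

variable {G} in
/-- The variable of the first segment of `e`. -/
def x (e : G.Edge) : G.MarkedRing 𝕜 := MvPolynomial.X (Sum.inl e)

variable {G} in
/-- The variable of the second segment of `e`. -/
def y (e : G.Edge) : G.MarkedRing 𝕜 := MvPolynomial.X (Sum.inr e)

/-- The framing ideal `F(G)` of the framing that puts the integer `ℓ e` on each thin edge `e`. -/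
def framingIdeal (ℓ : G.Edge → ℤ) : Ideal (G.MarkedRing 𝕜) :=
  Ideal.span (Set.range fun e : G.Edge => MvPolynomial.C (tpow 𝕜 (ℓ e)) * y 𝕜 e - x 𝕜 e)

/-- The linear ideal `L(G)`, generated by `(x_a + x_b) - (y_c + y_d)` for every thick edge with
outgoing thin edges `a`, `b` and incoming thin edges `c`, `d`. -/
def linearIdeal : Ideal (G.MarkedRing 𝕜) :=
  Ideal.span {p | ∃ v : G.Node, G.isThick v = true ∧
    p = (∑ e ∈ G.outEdges v, x 𝕜 e) - ∑ e ∈ G.inEdges v, y 𝕜 e}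

/-- The weight of a set of nodes: the sum of the framings on its internal thin edges. -/
def weight (ℓ : G.Edge → ℤ) (Γ : Finset G.Node) : ℤ := ∑ e ∈ G.internalEdges Γ, ℓ e

/-- The non-local ideal `N(G)`, generated by `t ^ weight(Γ) * x_{Γ,out} - y_{Γ,in}` for every set
`Γ` of thick edges and bivalent vertices. -/
def nonlocalIdeal (ℓ : G.Edge → ℤ) : Ideal (G.MarkedRing 𝕜) :=
  Ideal.span (Set.range fun Γ : Finset G.Node =>
    MvPolynomial.C (tpow 𝕜 (G.weight ℓ Γ)) * (∏ e ∈ G.setOut Γ, x 𝕜 e)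
      - ∏ e ∈ G.setIn Γ, y 𝕜 e)

/-- The edge ring `𝓔(G)`: polynomials over Laurent series with one variable per thin edge. -/
abbrev EdgeRing : Type _ := MvPolynomial G.Edge (LaurentSeries 𝕜)

/-- The projection onto the edge ring that retains `x e` and replaces `y e` by `t ^ (-ℓ e) x e`. -/
def toEdgeRing (ℓ : G.Edge → ℤ) : G.MarkedRing 𝕜 →ₐ[LaurentSeries 𝕜] G.EdgeRing 𝕜 :=
  MvPolynomial.aeval (Sum.elim (fun e => MvPolynomial.X e)
    (fun e => MvPolynomial.C (tpow 𝕜 (-ℓ e)) * MvPolynomial.X e))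

theorem toEdgeRing_surjective (ℓ : G.Edge → ℤ) : Function.Surjective (G.toEdgeRing 𝕜 ℓ) := by
  intro p
  refine ⟨MvPolynomial.rename Sum.inl p, ?_⟩
  rw [toEdgeRing, MvPolynomial.aeval_rename]
  exact MvPolynomial.aeval_X_left_apply p

/-- The edge ring is the quotient of the marked polynomial ring by the framing ideal. -/
theorem ker_toEdgeRing (ℓ : G.Edge → ℤ) :
    RingHom.ker (G.toEdgeRing 𝕜 ℓ) = G.framingIdeal 𝕜 ℓ := by
  have htt : ∀ k : ℤ, tpow 𝕜 (-k) * tpow 𝕜 k = 1 := by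
    intro k
    simp [tpow, HahnSeries.single_mul_single]
  apply le_antisymm
  · have key : ∀ p : G.MarkedRing 𝕜,
        p - MvPolynomial.rename Sum.inl (G.toEdgeRing 𝕜 ℓ p) ∈ G.framingIdeal 𝕜 ℓ := by
      intro p
      induction p using MvPolynomial.induction_on with
      | C a => simp [toEdgeRing]
      | add p q hp hq =>
        have := Ideal.add_mem _ hp hq
        simp only [map_add]
        convert this using 1
        ring
      | mul_X p i hp =>
        have hX : (MvPolynomial.X i : G.MarkedRing 𝕜)
            - MvPolynomial.rename Sum.inl (G.toEdgeRing 𝕜 ℓ (MvPolynomial.X i))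
            ∈ G.framingIdeal 𝕜 ℓ := by
          rcases i with e | e
          · simp [toEdgeRing]
          · have hg : MvPolynomial.C (tpow 𝕜 (ℓ e)) * y 𝕜 e - x 𝕜 e ∈ G.framingIdeal 𝕜 ℓ :=
              Ideal.subset_span ⟨e, rfl⟩
            have := Ideal.mul_mem_left _ (MvPolynomial.C (tpow 𝕜 (-ℓ e))) hg
            convert this using 1
            simp only [toEdgeRing, MvPolynomial.aeval_X, Sum.elim_inr, map_mul,
              MvPolynomial.rename_C, MvPolynomial.rename_X, x, y, mul_sub]
            rw [← mul_assoc, ← MvPolynomial.C_mul, htt]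
            simp
        have h1 := Ideal.mul_mem_right (MvPolynomial.X i) _ hp
        have h2 := Ideal.mul_mem_left _
          (MvPolynomial.rename Sum.inl (G.toEdgeRing 𝕜 ℓ p)) hX
        have := Ideal.add_mem _ h1 h2
        simp only [map_mul]
        convert this using 1
        ring
    intro p hp
    have := key p
    rw [RingHom.mem_ker] at hp
    rwa [hp, map_zero, sub_zero] at this
  · rw [framingIdeal, Ideal.span_le]
    rintro _ ⟨e, rfl⟩
    simp only [SetLike.mem_coe, RingHom.mem_ker, map_sub, map_mul, x, y, toEdgeRing,
      MvPolynomial.aeval_X, Sum.elim_inr, Sum.elim_inl, MvPolynomial.aeval_C,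
      MvPolynomial.algebraMap_eq]
    rw [← mul_assoc, ← MvPolynomial.C_mul, mul_comm (tpow 𝕜 (ℓ e)), htt]
    simp

/-- The image of `L(G)` in the edge ring. -/
def L (ℓ : G.Edge → ℤ) : Ideal (G.EdgeRing 𝕜) := (G.linearIdeal 𝕜).map (G.toEdgeRing 𝕜 ℓ)

/-- The image of `N(G)` in the edge ring. -/
def N (ℓ : G.Edge → ℤ) : Ideal (G.EdgeRing 𝕜) := (G.nonlocalIdeal 𝕜 ℓ).map (G.toEdgeRing 𝕜 ℓ)

/-- The module `Tor_i(𝓔/L, 𝓔/N)` over the edge ring `𝓔`.  Of the two constructions of `Tor` in the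
library this is the one that resolves the first argument. -/
abbrev TorMod (ℓ : G.Edge → ℤ) (i : ℕ) : Type _ :=
  ((CategoryTheory.Tor' (ModuleCat (G.EdgeRing 𝕜)) i).obj
    (ModuleCat.of (G.EdgeRing 𝕜) (G.EdgeRing 𝕜 ⧸ G.L 𝕜 ℓ))).obj
      (ModuleCat.of (G.EdgeRing 𝕜) (G.EdgeRing 𝕜 ⧸ G.N 𝕜 ℓ))

/-- The free module `V_G` over the edge ring spanned by the non-special components. -/
abbrev V (special : Set G.Component) : Type _ :=
  {c : G.Component // c ∉ special} →₀ G.EdgeRing 𝕜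

/-- The graph homology `𝓑(G) = Tor_*(𝓔/L, 𝓔/N) ⊗ Λ^* V_G` of a framed graph. -/
abbrev GraphHomology (ℓ : G.Edge → ℤ) (special : Set G.Component) : Type _ :=
  TensorProduct (G.EdgeRing 𝕜) (DirectSum ℕ fun i => G.TorMod 𝕜 ℓ i)
    (ExteriorAlgebra (G.EdgeRing 𝕜) (G.V 𝕜 special))

/-- The weight of a set of nodes in the knot Floer relations: twice the number of thick edges
(four-valent points) plus the number of bivalent vertices. -/
def floerWeight (W : Finset G.Node) : ℕ :=
  2 * (W.filter fun v => G.isThick v = true).card + (W.filter fun v => G.isThick v = false).card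

/-- The relations of the knot Floer graph homology, in variables `U_e` indexed by the thin edges:
* `t U_a + t U_b = U_c + U_d` and `t ^ 2 U_a U_b = U_c U_d` at a thick edge with outgoing edges
  `a`, `b` and incoming edges `c`, `d`;
* `t U_a = U_c` at a bivalent vertex with outgoing edge `a` and incoming edge `c`;
* `t ^ w(W) ∏ U_out = ∏ U_in` for every set `W` of thick edges and bivalent vertices. -/
inductive FloerRelation : G.EdgeRing 𝕜 → Prop
  | linear (v : G.Node) (hv : G.isThick v = true) :
      FloerRelation (MvPolynomial.C (tpow 𝕜 1) * (∑ e ∈ G.outEdges v, MvPolynomial.X e)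
        - ∑ e ∈ G.inEdges v, MvPolynomial.X e)
  | quadratic (v : G.Node) (hv : G.isThick v = true) :
      FloerRelation (MvPolynomial.C (tpow 𝕜 2) * (∏ e ∈ G.outEdges v, MvPolynomial.X e)
        - ∏ e ∈ G.inEdges v, MvPolynomial.X e)
  | bivalent (v : G.Node) (hv : G.isThick v = false) :
      FloerRelation (MvPolynomial.C (tpow 𝕜 1) * (∏ e ∈ G.outEdges v, MvPolynomial.X e)
        - ∏ e ∈ G.inEdges v, MvPolynomial.X e)
  | nonlocal (W : Finset G.Node) :
      FloerRelation (MvPolynomial.C (tpow 𝕜 (G.floerWeight W)) *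
          (∏ e ∈ G.setOut W, MvPolynomial.X e)
        - ∏ e ∈ G.setIn W, MvPolynomial.X e)

/-- The knot Floer graph homology `𝓐(G)`: the commutative algebra over Laurent series generated by
the thin edges, modulo the relations above. -/
abbrev FloerGraphHomology : Type _ :=
  G.EdgeRing 𝕜 ⧸ Ideal.span {p : G.EdgeRing 𝕜 | G.FloerRelation 𝕜 p}

end Algebra

end TrivalentGraph

/-- A letter of a resolved braid word on the strands `0, …, n`: a thick edge joining the
neighbouring strands `i` and `i + 1`, or a bivalent vertex on one strand.  The oriented resolution
of a crossing of the strands `i` and `i + 1` is the two letters `bivalent i`, `bivalent (i + 1)`. -/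
inductive BraidLetter (n : ℕ)
  | thick (i : Fin n)
  | bivalent (s : Fin (n + 1))

namespace BraidLetter

/-- The strands on which a letter lies. -/
def strands {n : ℕ} : BraidLetter n → Finset (Fin (n + 1))
  | thick i => {i.castSucc, i.succ}
  | bivalent s => {s}

/-- Whether the letter is a thick edge. -/
def isThick {n : ℕ} : BraidLetter n → Bool
  | thick _ => true
  | bivalent _ => false

theorem card_strands {n : ℕ} (l : BraidLetter n) :
    l.strands.card = if l.isThick then 2 else 1 := by
  cases l with
  | thick i =>
    have : i.castSucc ≠ i.succ := (Fin.castSucc_lt_succ).ne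
    simp [strands, isThick, this]
  | bivalent s => simp [strands, isThick]

end BraidLetter

namespace BraidWord

variable {n m : ℕ} (w : Fin m → BraidLetter n)

/-- The letters on strand `s`, as positions in the word (from the bottom of the braid to its top).
-/
def lettersOn (s : Fin (n + 1)) : Finset (Fin m) := Finset.univ.filter fun k => s ∈ (w k).strands

/-- The least element of a set of positions, if there is one. -/
def least (S : Finset (Fin m)) : Option (Fin m) := if h : S.Nonempty then some (S.min' h) else none

/-- The thin edges of the closure with strand `0` cut.  `none` is the thin edge that starts at the
bottom boundary vertex of strand `0`; `some (k, s)` is the thin edge that leaves the letter `k`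
upwards along strand `s`. -/
abbrev Edge : Type := Option {p : Fin m × Fin (n + 1) // p.2 ∈ (w p.1).strands}

/-- Where a thin edge starts. -/
def src : Edge w → Option (Fin m)
  | none => none
  | some p => some p.1.1

/-- Where a thin edge ends: at the next letter above on the same strand; if there is none, the edge
runs to the top boundary vertex on the cut strand `0`, and along the closure to the lowest
letter of its strand on the other strands. -/
def tgt : Edge w → Option (Fin m)
  | none => least (lettersOn w 0)
  | some p =>
    if ((lettersOn w p.1.2).filter fun k => p.1.1 < k).Nonempty then
      least ((lettersOn w p.1.2).filter fun k => p.1.1 < k)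
    else if p.1.2 = 0 then none
    else least (lettersOn w p.1.2)

/-- The strand on which a thin edge lies. -/
def strandOf : Edge w → Fin (n + 1)
  | none => 0
  | some p => p.1.2

theorem least_eq_some {S : Finset (Fin m)} {v : Fin m} :
    least S = some v ↔ v ∈ S ∧ ∀ k ∈ S, v ≤ k := by
  unfold least
  split_ifs with h
  · rw [Option.some_inj]
    constructor
    · rintro rfl
      exact ⟨S.min'_mem h, fun k hk => S.min'_le k hk⟩
    · rintro ⟨h1, h2⟩
      exact le_antisymm (S.min'_le v h1) (h2 _ (S.min'_mem h))
  · simp only [false_iff]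
    rintro ⟨h1, -⟩
    exact h ⟨v, h1⟩

theorem card_out (v : Fin m) :
    (Finset.univ.filter fun e : Edge w => src w e = some v).card
      = if (w v).isThick then 2 else 1 := by
  rw [← (w v).card_strands]
  refine Finset.card_bij (fun e _ => strandOf w e) ?_ ?_ ?_
  · rintro (_ | ⟨⟨k, s⟩, hs⟩) he
    · exact absurd (Finset.mem_filter.1 he).2 (by simp [src])
    · obtain rfl : k = v := Option.some_inj.1 (Finset.mem_filter.1 he).2
      exact hs
  · rintro (_ | ⟨⟨k, s⟩, hs⟩) he (_ | ⟨⟨k', s'⟩, hs'⟩) he' h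
    · rfl
    · exact absurd (Finset.mem_filter.1 he).2 (by simp [src])
    · exact absurd (Finset.mem_filter.1 he').2 (by simp [src])
    · obtain rfl : k = v := Option.some_inj.1 (Finset.mem_filter.1 he).2
      obtain rfl : k' = k := Option.some_inj.1 (Finset.mem_filter.1 he').2
      obtain rfl : s = s' := h
      rfl
  · intro s hs
    exact ⟨some ⟨(v, s), hs⟩, Finset.mem_filter.2 ⟨Finset.mem_univ _, rfl⟩, rfl⟩

theorem tgt_none_eq {v : Fin m} :
    tgt w none = some v ↔ v ∈ lettersOn w 0 ∧ ∀ k ∈ lettersOn w 0, v ≤ k := least_eq_some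

theorem tgt_some_eq {p : {p : Fin m × Fin (n + 1) // p.2 ∈ (w p.1).strands}} {v : Fin m} :
    tgt w (some p) = some v ↔
      (v ∈ lettersOn w p.1.2 ∧ p.1.1 < v ∧ ∀ k ∈ lettersOn w p.1.2, p.1.1 < k → v ≤ k) ∨
      (p.1.2 ≠ 0 ∧ v ∈ lettersOn w p.1.2 ∧ ∀ k ∈ lettersOn w p.1.2, k ≤ p.1.1 ∧ v ≤ k) := by
  simp only [tgt]
  split_ifs with h h0
  · rw [least_eq_some]
    simp only [Finset.mem_filter]
    constructor
    · rintro ⟨⟨h1, h2⟩, h3⟩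
      exact Or.inl ⟨h1, h2, fun k hk hlt => h3 k ⟨hk, hlt⟩⟩
    · rintro (⟨h1, h2, h3⟩ | ⟨-, -, h3⟩)
      · exact ⟨⟨h1, h2⟩, fun k hk => h3 k hk.1 hk.2⟩
      · obtain ⟨k, hk⟩ := h
        rw [Finset.mem_filter] at hk
        exact absurd hk.2 (not_lt.2 (h3 k hk.1).1)
  · simp only [false_iff]
    rintro (⟨h1, h2, -⟩ | ⟨h1, -⟩)
    · exact h ⟨v, by simp [h1, h2]⟩
    · exact h1 h0
  · rw [least_eq_some]
    constructor
    · rintro ⟨h1, h2⟩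
      refine Or.inr ⟨h0, h1, fun k hk => ⟨?_, h2 k hk⟩⟩
      by_contra hlt
      exact h ⟨k, by simp [hk, not_le.1 hlt]⟩
    · rintro (⟨h1, h2, -⟩ | ⟨-, h2, h3⟩)
      · exact absurd ⟨v, by simp [h1, h2]⟩ h
      · exact ⟨h2, fun k hk => (h3 k hk).2⟩

theorem mem_lettersOn {s : Fin (n + 1)} {k : Fin m} :
    k ∈ lettersOn w s ↔ s ∈ (w k).strands := by
  simp [lettersOn]

theorem card_in (v : Fin m) :
    (Finset.univ.filter fun e : Edge w => tgt w e = some v).card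
      = if (w v).isThick then 2 else 1 := by
  rw [← (w v).card_strands]
  refine Finset.card_bij (fun e _ => strandOf w e) ?_ ?_ ?_
  · rintro (_ | p) he
    · simp only [Finset.mem_filter, Finset.mem_univ, true_and, tgt_none_eq] at he
      exact (mem_lettersOn w).1 he.1
    · simp only [Finset.mem_filter, Finset.mem_univ, true_and, tgt_some_eq] at he
      rcases he with ⟨h, -⟩ | ⟨-, h, -⟩ <;> exact (mem_lettersOn w).1 h
  · rintro (_ | ⟨⟨k, s⟩, hs⟩) he (_ | ⟨⟨k', s'⟩, hs'⟩) he' h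
    · rfl
    · simp only [strandOf] at h
      subst h
      simp only [Finset.mem_filter, Finset.mem_univ, true_and, tgt_some_eq] at he'
      simp only [Finset.mem_filter, Finset.mem_univ, true_and, tgt_none_eq] at he
      have := he.2 k' ((mem_lettersOn w).2 hs')
      rcases he' with ⟨-, h2, -⟩ | ⟨h2, -⟩
      · exact absurd h2 (not_lt.2 this)
      · exact absurd rfl h2
    · simp only [strandOf] at h
      subst h
      simp only [Finset.mem_filter, Finset.mem_univ, true_and, tgt_some_eq] at he
      simp only [Finset.mem_filter, Finset.mem_univ, true_and, tgt_none_eq] at he'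
      have := he'.2 k ((mem_lettersOn w).2 hs)
      rcases he with ⟨-, h2, -⟩ | ⟨h2, -⟩
      · exact absurd h2 (not_lt.2 this)
      · exact absurd rfl h2
    · simp only [strandOf] at h
      subst h
      simp only [Finset.mem_filter, Finset.mem_univ, true_and, tgt_some_eq] at he he'
      have hk := (mem_lettersOn w).2 hs
      have hk' := (mem_lettersOn w).2 hs'
      have : k = k' := by
        apply le_antisymm
        · by_contra hlt
          rw [not_le] at hlt
          rcases he' with ⟨-, h2, h3⟩ | ⟨-, -, h3⟩
          · have h4 := h3 k hk hlt
            rcases he with ⟨-, h5, -⟩ | ⟨-, -, h5⟩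
            · exact absurd h5 (not_lt.2 h4)
            · exact absurd (lt_of_le_of_lt (h5 k' hk').2 h2) (lt_irrefl _)
          · exact absurd hlt (not_lt.2 (h3 k hk).1)
        · by_contra hlt
          rw [not_le] at hlt
          rcases he with ⟨-, h2, h3⟩ | ⟨-, -, h3⟩
          · have h4 := h3 k' hk' hlt
            rcases he' with ⟨-, h5, -⟩ | ⟨-, -, h5⟩
            · exact absurd h5 (not_lt.2 h4)
            · exact absurd (lt_of_le_of_lt (h5 k hk).2 h2) (lt_irrefl _)
          · exact absurd hlt (not_lt.2 (h3 k' hk').1)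
      subst this
      rfl
  · intro s hs
    have hv := (mem_lettersOn w).2 hs
    by_cases hb : ((lettersOn w s).filter fun k => k < v).Nonempty
    · obtain ⟨k, hm, hmax⟩ : ∃ k ∈ (lettersOn w s).filter (fun k => k < v),
          ∀ j ∈ (lettersOn w s).filter (fun k => k < v), j ≤ k :=
        ⟨_, Finset.max'_mem _ hb, Finset.le_max' _⟩
      rw [Finset.mem_filter] at hm
      refine ⟨some ⟨(k, s), (mem_lettersOn w).1 hm.1⟩, ?_, rfl⟩
      simp only [Finset.mem_filter, Finset.mem_univ, true_and, tgt_some_eq]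
      refine Or.inl ⟨hv, hm.2, fun j hj hlt => ?_⟩
      by_contra hjv
      exact absurd hlt (not_lt.2 (hmax j (by simp [hj, not_le.1 hjv])))
    · have hmin : ∀ k ∈ lettersOn w s, v ≤ k := by
        intro k hk
        by_contra hlt
        exact hb ⟨k, by simp [hk, not_le.1 hlt]⟩
      by_cases h0 : s = 0
      · subst h0
        refine ⟨none, ?_, rfl⟩
        simp only [Finset.mem_filter, Finset.mem_univ, true_and, tgt_none_eq]
        exact ⟨hv, hmin⟩
      · have hne : (lettersOn w s).Nonempty := ⟨v, hv⟩
        obtain ⟨k, hm, hmax⟩ : ∃ k ∈ lettersOn w s, ∀ j ∈ lettersOn w s, j ≤ k :=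
          ⟨_, Finset.max'_mem _ hne, Finset.le_max' _⟩
        refine ⟨some ⟨(k, s), (mem_lettersOn w).1 hm⟩, ?_, rfl⟩
        simp only [Finset.mem_filter, Finset.mem_univ, true_and, tgt_some_eq]
        exact Or.inr ⟨h0, hv, fun j hj => ⟨hmax j hj, hmin j hj⟩⟩

end BraidWord

/-- The closed braid graph of a resolved braid word: all strands but the outermost strand `0` are
closed, and strand `0` is left cut, with a bottom and a top boundary vertex. -/
def closedBraidGraph {n m : ℕ} (w : Fin m → BraidLetter n) : TrivalentGraph where
  Edge := BraidWord.Edge w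
  Node := Fin m
  isThick k := (w k).isThick
  src := BraidWord.src w
  tgt := BraidWord.tgt w
  card_out := BraidWord.card_out w
  card_in := BraidWord.card_in w

/-- The outermost component of a closed braid graph, the one containing the cut edge, is the only
special component. -/
def outermostSpecial {n m : ℕ} (w : Fin m → BraidLetter n) :
    Set (closedBraidGraph w).Component :=
  {(closedBraidGraph w).componentOf (none : BraidWord.Edge w)}

/-! With all framings 1, rescaling generators by powers of t turns L + N into the ideal of the Floer
relations; the quadratic and bivalent ones already follow from one-node sets (`span_floerRelation`).
So 𝓐(G) is Tor_0, and the content is that everything else vanishes.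

If some component misses the cut strand, the set of all its nodes has no entering or leaving edge,
so N contains the unit t^w - 1 up to scaling and both sides are zero (`N_eq_top`). Otherwise V_G =
0, and it suffices that the linear relations are a regular sequence both on the edge ring and modulo
N: iterated mapping cones then give a projective resolution of 𝓔/L that stays exact after tensoring
with 𝓔/N (`HasTorAcyclicResolution.sup_span_list`).

Regularity is proved by degenerating to t = 0 over 𝕜[[t]]. There N becomes a monomial ideal and each
linear relation the sum of the two edges entering a thick edge; an induction splitting off one
variable at a time gives regularity (`isRegularMod_cutIdeal`). It lifts to power series because
everything is homogeneous and the family has no t-torsion (`IsRegularMod.of_map`), and then passes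
to Laurent series by localization.

Absence of t-torsion (`mem_nonlocalSpan_of_C_mul_mem`) uses connectedness: it yields a potential on
the edges that drops across each non-local relation by exactly its power of t. Rewriting along the
relations therefore ends in standard monomials, and these are separated by their classes modulo
gradients. -/

/-! ### Weakly regular sequences modulo an ideal. -/

/-- The list `l` is a weakly regular sequence on the quotient of the ring by the ideal `I`. -/
def IsRegularMod {R : Type*} [CommRing R] (I : Ideal R) : List R → Prop
  | [] => True
  | a :: l => (∀ f, a * f ∈ I → f ∈ I) ∧ IsRegularMod (I ⊔ Ideal.span {a}) l

namespace IsRegularMod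

variable {R : Type*} [CommRing R]

theorem top : ∀ l : List R, IsRegularMod (⊤ : Ideal R) l
  | [] => trivial
  | a :: l => ⟨fun _ _ => trivial, by rw [top_sup_eq]; exact top l⟩

theorem mem_sup_span_singleton {I : Ideal R} {a f : R} :
    f ∈ I ⊔ Ideal.span {a} ↔ ∃ g, f - a * g ∈ I := by
  rw [Submodule.mem_sup]
  constructor
  · rintro ⟨i, hi, z, hz, rfl⟩
    obtain ⟨g, rfl⟩ := Ideal.mem_span_singleton'.1 hz
    exact ⟨g, by convert hi using 1; ring⟩
  · rintro ⟨g, hg⟩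
    exact ⟨_, hg, a * g, Ideal.mul_mem_right _ _ (Ideal.mem_span_singleton_self a), by ring⟩

/-- Weak regularity is stable under the extension
`0 → R / (I : s) → R / I → R / (I + (s)) → 0`. -/
theorem of_colon {s : R} : ∀ {l : List R} {I J : Ideal R}, (∀ f, s * f ∈ I ↔ f ∈ J) →
    IsRegularMod J l → IsRegularMod (I ⊔ Ideal.span {s}) l → IsRegularMod I l
  | [], _, _, _, _, _ => trivial
  | a :: l, I, J, hJ, h₁, h₂ => by
    refine ⟨fun f hf => ?_, of_colon (s := s) (J := J ⊔ Ideal.span {a}) (fun f => ?_) h₁.2 ?_⟩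
    · obtain ⟨g, hg⟩ := mem_sup_span_singleton.1 (h₂.1 f (Ideal.mem_sup_left hf))
      have hsg : s * (a * g) ∈ I := by
        have := Ideal.sub_mem _ hf (Ideal.mul_mem_left _ a hg)
        convert this using 1; ring
      have := (hJ g).2 (h₁.1 g ((hJ _).1 hsg))
      simpa using Ideal.add_mem _ hg this
    · rw [mem_sup_span_singleton, mem_sup_span_singleton]
      constructor
      -- Regularity of `a` modulo `I + (s)` is what makes the colon by `s` commute with adding `a`:
      -- it forces `g ≡ s * h` modulo `I`, and then `s * (f - a * h) ∈ I`.
      · rintro ⟨g, hg⟩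
        have hag : a * g ∈ I ⊔ Ideal.span {s} :=
          mem_sup_span_singleton.2 ⟨f, by rw [← neg_mem_iff]; convert hg using 1; ring⟩
        obtain ⟨h, hh⟩ := mem_sup_span_singleton.1 (h₂.1 g hag)
        refine ⟨h, (hJ _).1 ?_⟩
        have := Ideal.add_mem _ hg (Ideal.mul_mem_left _ a hh)
        convert this using 1; ring
      · rintro ⟨g, hg⟩
        exact ⟨s * g, by convert (hJ _).2 hg using 1; ring⟩
    · rw [sup_right_comm]
      exact h₂.2

end IsRegularMod

/-! ### The special fibre t = 0: monomial cut ideals. -/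

namespace TrivalentGraph

open MvPolynomial

variable (G : TrivalentGraph)

section SpecialFibre

variable (k : Type*) [Field k]

/-- The exponent of the product of the edges in `F` that enter `Γ`. -/
noncomputable def cutExponent (F : Finset G.Edge) (Γ : Finset G.Node) : G.Edge →₀ ℕ :=
  ∑ e ∈ F ∩ G.setIn Γ, Finsupp.single e 1

theorem cutExponent_apply (F : Finset G.Edge) (Γ : Finset G.Node) (e : G.Edge) :
    G.cutExponent F Γ e = if e ∈ F ∧ e ∈ G.setIn Γ then 1 else 0 := by
  simp [cutExponent, Finsupp.finsetSum_apply, Finsupp.single_apply]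

/-- The exponents of the generators of the cut ideal. -/
def cutExponents (F : Finset G.Edge) (D : Finset G.Node) (Z : Finset G.Edge) :
    Set (G.Edge →₀ ℕ) :=
  {m | ∃ Γ, Γ.Nonempty ∧ Γ ⊆ D ∧ m = G.cutExponent F Γ} ∪ {m | ∃ e ∈ Z, m = Finsupp.single e 1}

/-- The monomial ideal generated by the edges in `Z` and by the products of the edges of `F` that
enter `Γ`, over all nonempty `Γ ⊆ D`. -/
noncomputable def cutIdeal (F : Finset G.Edge) (D : Finset G.Node) (Z : Finset G.Edge) :
    Ideal (MvPolynomial G.Edge k) :=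
  Ideal.span ((fun m => monomial m (1 : k)) '' G.cutExponents F D Z)

variable {G}

theorem mem_setIn {Γ : Finset G.Node} {e : G.Edge} :
    e ∈ G.setIn Γ ↔ (∀ u ∈ Γ, G.src e ≠ some u) ∧ ∃ v ∈ Γ, G.tgt e = some v := by
  simp [setIn, StartsIn, EndsIn]

theorem mem_setOut {Γ : Finset G.Node} {e : G.Edge} :
    e ∈ G.setOut Γ ↔ (∃ v ∈ Γ, G.src e = some v) ∧ ∀ u ∈ Γ, G.tgt e ≠ some u := by
  simp [setOut, StartsIn, EndsIn]

theorem mem_cutIdeal {F : Finset G.Edge} {D : Finset G.Node} {Z : Finset G.Edge}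
    {f : MvPolynomial G.Edge k} :
    f ∈ G.cutIdeal k F D Z ↔ ∀ m ∈ f.support, ∃ a ∈ G.cutExponents F D Z, a ≤ m :=
  mem_ideal_span_monomial_image

variable {F : Finset G.Edge} {D : Finset G.Node} {Z : Finset G.Edge} {e : G.Edge} {v : G.Node}

/-- The generators are squarefree monomials, so the colon by `X e` just deletes `e` from them. If
`e` were in `Z`, the colon would be the whole ring. -/
theorem X_mul_mem_cutIdeal_iff (hZ : e ∉ Z) (f : MvPolynomial G.Edge k) :
    X e * f ∈ G.cutIdeal k F D Z ↔ f ∈ G.cutIdeal k (F.erase e) D Z := by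
  have hsupp : ∀ m, m ∈ f.support ↔ m + Finsupp.single e 1 ∈ (X e * f).support := fun m => by
    rw [mul_comm, mem_support_iff, mem_support_iff, coeff_mul_X]
  rw [mem_cutIdeal, mem_cutIdeal]
  constructor
  · intro h m hm
    obtain ⟨a, (⟨Γ, hΓ, hΓD, rfl⟩ | ⟨z, hz, rfl⟩), ham⟩ := h _ ((hsupp m).1 hm)
    · refine ⟨_, Or.inl ⟨Γ, hΓ, hΓD, rfl⟩, fun i => ?_⟩
      have := ham i
      simp only [Finsupp.add_apply, cutExponent_apply, Finset.mem_erase, Finsupp.single_apply]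
        at this ⊢
      grind
    · refine ⟨_, Or.inr ⟨z, hz, rfl⟩, fun i => ?_⟩
      have := ham i
      simp only [Finsupp.add_apply, Finsupp.single_apply] at this ⊢
      grind
  · intro h m hm
    obtain ⟨m, rfl⟩ : ∃ m', m = m' + Finsupp.single e 1 := by
      classical
      rw [mul_comm, support_mul_X, Finset.mem_map] at hm
      obtain ⟨m', -, rfl⟩ := hm
      exact ⟨m', rfl⟩
    obtain ⟨a, (⟨Γ, hΓ, hΓD, rfl⟩ | ⟨z, hz, rfl⟩), ham⟩ := h _ ((hsupp m).2 hm)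
    · refine ⟨_, Or.inl ⟨Γ, hΓ, hΓD, rfl⟩, fun i => ?_⟩
      have := ham i
      simp only [Finsupp.add_apply, cutExponent_apply, Finset.mem_erase, Finsupp.single_apply]
        at this ⊢
      grind
    · exact ⟨_, Or.inr ⟨z, hz, rfl⟩, ham.trans le_self_add⟩

/-- Since `e` starts outside `D`, it enters every `Γ ⊆ D` containing `v`. Modulo `X e` only the sets
avoiding `v` still contribute. -/
theorem cutIdeal_sup_span_X (he : e ∈ F) (ht : G.tgt e = some v)
    (hs : ∀ u ∈ D, G.src e ≠ some u) :
    G.cutIdeal k F D Z ⊔ Ideal.span {X e} = G.cutIdeal k F (D.erase v) (insert e Z) := by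
  apply le_antisymm
  · refine sup_le (Ideal.span_le.2 ?_) ((Ideal.span_singleton_le_iff_mem _).2
      (Ideal.subset_span ⟨_, Or.inr ⟨e, Finset.mem_insert_self _ _, rfl⟩, rfl⟩))
    rintro _ ⟨_, (⟨Γ, hΓ, hΓD, rfl⟩ | ⟨z, hz, rfl⟩), rfl⟩
    · rw [SetLike.mem_coe, mem_cutIdeal]
      intro m hm
      rw [Finset.mem_singleton.1 (support_monomial_subset hm)]
      by_cases hvΓ : v ∈ Γ
      · refine ⟨_, Or.inr ⟨e, Finset.mem_insert_self _ _, rfl⟩, Finsupp.single_le_iff.2 ?_⟩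
        rw [cutExponent_apply, if_pos ⟨he, mem_setIn.2 ⟨fun u hu => hs u (hΓD hu), v, hvΓ, ht⟩⟩]
      · exact ⟨_, Or.inl ⟨Γ, hΓ, Finset.subset_erase.2 ⟨hΓD, hvΓ⟩, rfl⟩, le_rfl⟩
    · exact Ideal.subset_span ⟨_, Or.inr ⟨z, Finset.mem_insert_of_mem hz, rfl⟩, rfl⟩
  · refine Ideal.span_le.2 ?_
    rintro _ ⟨_, (⟨Γ, hΓ, hΓD, rfl⟩ | ⟨z, hz, rfl⟩), rfl⟩
    · exact Ideal.mem_sup_left (Ideal.subset_span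
        ⟨_, Or.inl ⟨Γ, hΓ, hΓD.trans (Finset.erase_subset _ _), rfl⟩, rfl⟩)
    · rcases Finset.mem_insert.1 hz with rfl | hz
      · exact Ideal.mem_sup_right (Ideal.mem_span_singleton_self _)
      · exact Ideal.mem_sup_left (Ideal.subset_span ⟨_, Or.inr ⟨z, hz, rfl⟩, rfl⟩)

/-- No edge of `F` enters `D` from outside, so the generator of `Γ = D` is an empty product. -/
theorem cutIdeal_eq_top (hD : D.Nonempty)
    (h : ∀ e ∈ F, ∀ v ∈ D, G.tgt e = some v → ∃ u ∈ D, G.src e = some u) :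
    G.cutIdeal k F D Z = ⊤ := by
  rw [Ideal.eq_top_iff_one]
  refine Ideal.subset_span ⟨_, Or.inl ⟨D, hD, subset_rfl, rfl⟩, ?_⟩
  have : F ∩ G.setIn D = ∅ := by
    ext e
    simp only [Finset.mem_inter, mem_setIn, Finset.notMem_empty, iff_false]
    rintro ⟨he, h1, v, hv, ht⟩
    obtain ⟨u, hu, hs⟩ := h e he v hv ht
    exact h1 u hu hs
  simp [cutExponent, this]

variable (G) in
/-- The sum of the variables of the edges that enter `v`. -/
noncomputable def inSum (v : G.Node) : MvPolynomial G.Edge k := ∑ e ∈ G.inEdges v, X e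

variable (G) in
/-- The substitution that kills the edges in `Z` and the sums `inSum v` for `v ∈ S`, by eliminating
the variable of the edge `c v`. -/
noncomputable def eliminate (c : G.Node → G.Edge) (Z : Finset G.Edge) (S : Set G.Node) :
    MvPolynomial G.Edge k →ₐ[k] MvPolynomial G.Edge k :=
  open Classical in
  aeval fun e => if e ∈ Z then 0 else
    if ∃ v ∈ S, e = c v then
      (match G.tgt e with
      | none => 0
      | some v => -∑ e' ∈ (G.inEdges v).filter (fun e' => e' ≠ e ∧ e' ∉ Z), X e')
    else X e

variable {c : G.Node → G.Edge} {S : Set G.Node}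

theorem mem_inEdges {v : G.Node} {e : G.Edge} : e ∈ G.inEdges v ↔ G.tgt e = some v := by
  simp [inEdges]

theorem eliminate_inSum (hc : ∀ v, G.isThick v = true → c v ∈ G.inEdges v ∧ c v ∉ Z)
    (hS : ∀ v ∈ S, G.isThick v = true) (hv : G.isThick v = true) (hvS : v ∈ S) :
    G.eliminate k c Z S (G.inSum k v) = 0 := by
  classical
  have hne : ∀ e ∈ G.inEdges v, e ≠ c v → ¬ ∃ u ∈ S, e = c u := by
    rintro e he hec ⟨u, hu, rfl⟩
    have h1 := mem_inEdges.1 he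
    have h2 := mem_inEdges.1 (hc u (hS u hu)).1
    rw [h1, Option.some_inj] at h2
    exact hec (by rw [h2])
  rw [inSum, map_sum, ← Finset.add_sum_erase _ _ (hc v hv).1]
  have h1 : G.eliminate k c Z S (X (c v)) =
      -∑ e' ∈ (G.inEdges v).filter (fun e' => e' ≠ c v ∧ e' ∉ Z), X e' := by
    rw [eliminate, aeval_X, if_neg (hc v hv).2, if_pos ⟨v, hvS, rfl⟩, mem_inEdges.1 (hc v hv).1]
  have h2 : ∑ e ∈ (G.inEdges v).erase (c v), G.eliminate k c Z S (X e) =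
      ∑ e' ∈ (G.inEdges v).filter (fun e' => e' ≠ c v ∧ e' ∉ Z), X e' := by
    have : (G.inEdges v).filter (fun e' => e' ≠ c v ∧ e' ∉ Z) =
        ((G.inEdges v).erase (c v)).filter (fun e' => e' ∉ Z) := by
      ext e; simp only [Finset.mem_filter, Finset.mem_erase]; tauto
    rw [this, Finset.sum_filter]
    refine Finset.sum_congr rfl fun e he => ?_
    rw [Finset.mem_erase] at he
    rw [eliminate, aeval_X, if_neg (hne e he.2 he.1)]
    by_cases heZ : e ∈ Z <;> simp [heZ]
  rw [h1, h2, neg_add_cancel]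

/-- Each edge has one target, so eliminations at nodes of `S` do not touch the edges entering `v`;
the coefficient of `X (c v)` survives. -/
theorem eliminate_inSum_ne_zero (hc : ∀ v, G.isThick v = true → c v ∈ G.inEdges v ∧ c v ∉ Z)
    (hS : ∀ v ∈ S, G.isThick v = true) (hv : G.isThick v = true) (hvS : v ∉ S) :
    G.eliminate k c Z S (G.inSum k v) ≠ 0 := by
  classical
  have hne : ∀ e ∈ G.inEdges v, ¬ ∃ u ∈ S, e = c u := by
    rintro e he ⟨u, hu, rfl⟩
    have h1 := mem_inEdges.1 he
    have h2 := mem_inEdges.1 (hc u (hS u hu)).1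
    rw [h1, Option.some_inj] at h2
    exact hvS (h2 ▸ hu)
  intro h
  have h1 := congrArg (coeff (Finsupp.single (c v) 1)) h
  rw [inSum, map_sum, coeff_sum, ← Finset.add_sum_erase _ _ (hc v hv).1, Finset.sum_eq_zero] at h1
  · simp [eliminate, (hc v hv).2, hne _ (hc v hv).1] at h1
  · intro e he
    rw [Finset.mem_erase] at he
    rw [eliminate, aeval_X, if_neg (hne e he.2)]
    by_cases heZ : e ∈ Z
    · simp [heZ]
    · simp [heZ, coeff_X, Finsupp.single_left_inj, he.1]

/-- The substitution is the identity modulo the right-hand ideal, which gives the nontrivial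
inclusion. The use of this lemma is that the ideal is prime, being the kernel of a map to a domain.
-/
theorem ker_eliminate (hc : ∀ v, G.isThick v = true → c v ∈ G.inEdges v ∧ c v ∉ Z)
    (hS : ∀ v ∈ S, G.isThick v = true) :
    RingHom.ker (G.eliminate k c Z S) =
      G.cutIdeal k F ∅ Z ⊔ Ideal.span (G.inSum k '' S) := by
  classical
  have hX : ∀ z ∈ Z, X z ∈ G.cutIdeal k F ∅ Z :=
    fun z hz => Ideal.subset_span ⟨_, Or.inr ⟨z, hz, rfl⟩, rfl⟩
  apply le_antisymm
  · set I := G.cutIdeal k F ∅ Z ⊔ Ideal.span (G.inSum k '' S)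
    have key : (Ideal.Quotient.mkₐ k I).comp (G.eliminate k c Z S) = Ideal.Quotient.mkₐ k I := by
      refine MvPolynomial.algHom_ext fun e => ?_
      rw [AlgHom.comp_apply, Ideal.Quotient.mkₐ_eq_mk, Ideal.Quotient.eq, eliminate, aeval_X]
      split_ifs with h1 h2
      · rw [zero_sub, neg_mem_iff]
        exact Ideal.mem_sup_left (hX e h1)
      · obtain ⟨v, hv, rfl⟩ := h2
        rw [mem_inEdges.1 (hc v (hS v hv)).1]
        have h3 : G.inSum k v ∈ I := Ideal.mem_sup_right (Ideal.subset_span ⟨v, hv, rfl⟩)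
        have h4 : ∑ e ∈ ((G.inEdges v).erase (c v)).filter (fun e => ¬ e ∉ Z), X e ∈ I := by
          refine Ideal.sum_mem _ fun e he => Ideal.mem_sup_left (hX e ?_)
          simpa using (Finset.mem_filter.1 he).2
        have : (G.inEdges v).filter (fun e' => e' ≠ c v ∧ e' ∉ Z) =
            ((G.inEdges v).erase (c v)).filter (fun e' => e' ∉ Z) := by
          ext e; simp only [Finset.mem_filter, Finset.mem_erase]; tauto
        have h5 := Ideal.sub_mem _ h4 h3
        rw [inSum, ← Finset.add_sum_erase _ _ (hc v (hS v hv)).1,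
          ← Finset.sum_filter_add_sum_filter_not ((G.inEdges v).erase (c v)) (fun e => e ∉ Z)] at h5
        simp only [this]
        convert h5 using 1
        ring
      · simp
    intro f hf
    have := DFunLike.congr_fun key f
    rw [AlgHom.comp_apply, (RingHom.mem_ker).1 hf, map_zero] at this
    exact Ideal.Quotient.eq_zero_iff_mem.1 this.symm
  · refine sup_le (Ideal.span_le.2 ?_) (Ideal.span_le.2 ?_)
    · rintro _ ⟨_, (⟨Γ, hΓ, hΓD, rfl⟩ | ⟨z, hz, rfl⟩), rfl⟩
      · exact absurd hΓ (by simp [Finset.subset_empty.1 hΓD])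
      · change G.eliminate k c Z S (X z) = 0
        rw [eliminate, aeval_X, if_pos hz]
    · rintro _ ⟨v, hv, rfl⟩
      exact eliminate_inSum k hc hS (hS v hv) hv

theorem isRegularMod_inSum_of_empty (hc : ∀ v, G.isThick v = true → c v ∈ G.inEdges v ∧ c v ∉ Z) :
    ∀ (l : List G.Node) (S : Set G.Node), l.Nodup → (∀ v ∈ l, G.isThick v = true ∧ v ∉ S) →
      (∀ v ∈ S, G.isThick v = true) →
      IsRegularMod (G.cutIdeal k F ∅ Z ⊔ Ideal.span (G.inSum k '' S)) (l.map (G.inSum k))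
  | [], _, _, _, _ => trivial
  | v :: l, S, hl, hlS, hS => by
    rw [List.nodup_cons] at hl
    obtain ⟨hv, hvS⟩ := hlS v (by simp)
    refine ⟨fun f hf => ?_, ?_⟩
    · rw [← ker_eliminate k hc hS, RingHom.mem_ker] at hf ⊢
      rw [map_mul] at hf
      exact (mul_eq_zero.1 hf).resolve_left (eliminate_inSum_ne_zero k hc hS hv hvS)
    · have := isRegularMod_inSum_of_empty hc l (insert v S) hl.2
        (fun u hu => ⟨(hlS u (by simp [hu])).1, ?_⟩) ?_
      · rw [Set.image_insert_eq, Ideal.span_insert, sup_comm (Ideal.span {_}), ← sup_assoc] at this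
        exact this
      · rintro (rfl | h)
        · exact hl.1 hu
        · exact (hlS u (by simp [hu])).2 h
      · rintro u (rfl | h)
        · exact hv
        · exact hS u h

/-- Induction on `D.card + F.card` through the exact sequence of `IsRegularMod.of_colon`, with `s`
the variable of an edge entering `D` from outside: the colon shrinks `F`, the quotient shrinks `D`.
The hypotheses on `Z` are the invariant: a node loses at most one entering edge to `Z`, and only on
leaving `D`, so a thick node always keeps one. -/
theorem isRegularMod_cutIdeal_aux {l : List G.Node} (hl : l.Nodup)
    (hlt : ∀ v ∈ l, G.isThick v = true) :
    ∀ (N : ℕ) (F : Finset G.Edge) (D : Finset G.Node) (Z : Finset G.Edge), D.card + F.card = N →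
      (∀ v ∈ D, ∀ e ∈ G.inEdges v, e ∉ Z) →
      (∀ v, G.isThick v = true → ∃ e ∈ G.inEdges v, e ∉ Z) →
      IsRegularMod (G.cutIdeal k F D Z) (l.map (G.inSum k)) := by
  intro N
  induction N using Nat.strong_induction_on with
  | _ N ih =>
    intro F D Z hN hD hZ
    rcases D.eq_empty_or_nonempty with rfl | hne
    · rcases isEmpty_or_nonempty G.Edge with hE | hE
      · cases l with
        | nil => trivial
        | cons v l => exact hE.elim (hZ v (hlt v (by simp))).choose
      choose! c hc using hZ
      have := isRegularMod_inSum_of_empty (F := F) k hc l ∅ hl (fun v hv => ⟨hlt v hv, by simp⟩)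
        (by simp)
      simpa using this
    · by_cases h : ∀ e ∈ F, ∀ v ∈ D, G.tgt e = some v → ∃ u ∈ D, G.src e = some u
      · rw [cutIdeal_eq_top k hne h]
        exact IsRegularMod.top _
      · push Not at h
        obtain ⟨e, he, v, hv, ht, hs⟩ := h
        have hFc := Finset.card_erase_lt_of_mem he
        have hDc := Finset.card_erase_lt_of_mem hv
        refine IsRegularMod.of_colon
          (X_mul_mem_cutIdeal_iff k (hD v hv e (mem_inEdges.2 ht))) ?_ ?_
        · exact ih _ (by omega) _ _ _ rfl hD hZ
        · rw [cutIdeal_sup_span_X k he ht hs]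
          refine ih _ (by omega) _ _ _ rfl ?_ ?_
          · intro u hu e' he' h'
            rw [Finset.mem_erase] at hu
            rcases Finset.mem_insert.1 h' with rfl | h'
            · rw [mem_inEdges, ht, Option.some_inj] at he'
              exact hu.1 he'.symm
            · exact hD u hu.2 e' he' h'
          · intro u hu
            by_cases huv : u = v
            · subst huv
              have h2 : (G.inEdges u).card = 2 := by
                have := G.card_in u
                rwa [if_pos hu] at this
              obtain ⟨e', he', hee'⟩ := Finset.exists_mem_ne (s := G.inEdges u) (by omega) e
              exact ⟨e', he', by simp [hee', hD u hv e' he']⟩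
            · obtain ⟨e', he', he'Z⟩ := hZ u hu
              refine ⟨e', he', ?_⟩
              rw [Finset.mem_insert, not_or]
              refine ⟨?_, he'Z⟩
              rintro rfl
              rw [mem_inEdges, ht, Option.some_inj] at he'
              exact huv he'.symm

/-- The sums of the two edges entering each thick edge form a regular sequence modulo the cut
ideal. -/
theorem isRegularMod_cutIdeal {l : List G.Node} (hl : l.Nodup)
    (hlt : ∀ v ∈ l, G.isThick v = true) (F : Finset G.Edge) (D : Finset G.Node) :
    IsRegularMod (G.cutIdeal k F D ∅) (l.map (G.inSum k)) := by
  refine isRegularMod_cutIdeal_aux k hl hlt _ F D ∅ rfl (by simp) fun v hv => ?_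
  have h2 : (G.inEdges v).card = 2 := by
    have := G.card_in v
    rwa [if_pos hv] at this
  obtain ⟨e, he⟩ := Finset.card_pos.1 (by omega : 0 < (G.inEdges v).card)
  exact ⟨e, he, by simp⟩

end SpecialFibre

end TrivalentGraph

/-! ### Incidence counts and flow conservation. -/

namespace TrivalentGraph

open MvPolynomial

variable (G : TrivalentGraph)

section Incidence

variable {G}

theorem mem_outEdges {v : G.Node} {e : G.Edge} : e ∈ G.outEdges v ↔ G.src e = some v := by
  simp [outEdges]

theorem card_inEdges (v : G.Node) : (G.inEdges v).card = if G.isThick v then 2 else 1 := G.card_in v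

theorem card_outEdges (v : G.Node) : (G.outEdges v).card = if G.isThick v then 2 else 1 :=
  G.card_out v

theorem card_inEdges_pos (v : G.Node) : 0 < (G.inEdges v).card := by
  rw [card_inEdges]; split_ifs <;> norm_num

theorem sum_inEdges {M : Type*} [AddCommMonoid M] (f : G.Edge → M) (Γ : Finset G.Node) :
    ∑ v ∈ Γ, ∑ e ∈ G.inEdges v, f e = ∑ e ∈ G.setIn Γ, f e + ∑ e ∈ G.internalEdges Γ, f e := by
  rw [← Finset.sum_biUnion, add_comm]
  · have : Γ.biUnion G.inEdges = Finset.univ.filter (G.EndsIn Γ) := by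
      ext e; simp [mem_inEdges, EndsIn]
    rw [this, ← Finset.sum_filter_add_sum_filter_not _ (G.StartsIn Γ), Finset.filter_filter,
      Finset.filter_filter]
    simp only [setIn, internalEdges, and_comm]
  · intro u _ v _ huv
    refine Finset.disjoint_left.2 fun e he he' => huv ?_
    simpa [mem_inEdges.1 he] using mem_inEdges.1 he'

theorem sum_outEdges {M : Type*} [AddCommMonoid M] (f : G.Edge → M) (Γ : Finset G.Node) :
    ∑ v ∈ Γ, ∑ e ∈ G.outEdges v, f e = ∑ e ∈ G.setOut Γ, f e + ∑ e ∈ G.internalEdges Γ, f e := by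
  rw [← Finset.sum_biUnion, add_comm]
  · have : Γ.biUnion G.outEdges = Finset.univ.filter (G.StartsIn Γ) := by
      ext e; simp [mem_outEdges, StartsIn]
    rw [this, ← Finset.sum_filter_add_sum_filter_not _ (G.EndsIn Γ), Finset.filter_filter,
      Finset.filter_filter]
    simp only [setOut, internalEdges]
  · intro u _ v _ huv
    refine Finset.disjoint_left.2 fun e he he' => huv ?_
    simpa [mem_outEdges.1 he] using mem_outEdges.1 he'

theorem floerWeight_eq_sum (Γ : Finset G.Node) :
    G.floerWeight Γ = ∑ v ∈ Γ, (G.inEdges v).card := by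
  simp only [card_inEdges, floerWeight, Finset.sum_ite, Finset.sum_const, smul_eq_mul, mul_one]
  simp [mul_comm]

theorem floerWeight_pos {Γ : Finset G.Node} (hΓ : Γ.Nonempty) : 0 < G.floerWeight Γ := by
  rw [floerWeight_eq_sum]
  exact Finset.sum_pos (fun v _ => card_inEdges_pos v) hΓ

/-- This count is why the weight of the all-one framing becomes the Floer weight once each entering
`y` is rewritten through `x`. -/
theorem card_setIn_add_card_internalEdges (Γ : Finset G.Node) :
    (G.setIn Γ).card + (G.internalEdges Γ).card = G.floerWeight Γ := by
  have := sum_inEdges (fun _ => 1) Γ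
  simp only [Finset.sum_const, smul_eq_mul, mul_one] at this
  rw [floerWeight_eq_sum, this]

/-- In-degree equals out-degree at every node, and internal edges cancel. This makes the non-local
relations homogeneous. -/
theorem card_setOut_eq (Γ : Finset G.Node) : (G.setOut Γ).card = (G.setIn Γ).card := by
  have h1 := sum_inEdges (fun _ => 1) Γ
  have h2 := sum_outEdges (fun _ => 1) Γ
  simp only [Finset.sum_const, smul_eq_mul, mul_one, card_inEdges, card_outEdges] at h1 h2
  omega

end Incidence

/-! ### Potentials on a connected graph with boundary. -/

section Potential

/-- The indicator function of an endpoint, zero at the boundary. -/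
def endpointIndicator (o : Option G.Node) (v : G.Node) : ℤ := if o = some v then 1 else 0

/-- The inflow minus the outflow of a function on the edges, at each node. -/
def boundaryMap : (G.Edge → ℤ) →ₗ[ℤ] (G.Node → ℤ) where
  toFun c v := ∑ e ∈ G.inEdges v, c e - ∑ e ∈ G.outEdges v, c e
  map_add' c d := by
    ext v; simp only [Pi.add_apply, Finset.sum_add_distrib]; ring
  map_smul' r c := by
    ext v; simp only [Pi.smul_apply, ← Finset.smul_sum, smul_sub, RingHom.id_apply]

variable {G}

theorem boundaryMap_single (e : G.Edge) :
    G.boundaryMap (Pi.single e 1) =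
      G.endpointIndicator (G.tgt e) - G.endpointIndicator (G.src e) := by
  ext v
  simp [boundaryMap, endpointIndicator, mem_inEdges, mem_outEdges]

/-- Modulo the range, every edge identifies the indicators of its two ends. The boundary end of `e₀`
has indicator zero, and connectedness spreads this to all nodes. -/
theorem boundaryMap_surjective {e₀ : G.Edge} (h₀ : G.src e₀ = none)
    (hconn : ∀ e, G.componentOf e = G.componentOf e₀) : Function.Surjective G.boundaryMap := by
  rw [← LinearMap.range_eq_top]
  set W := LinearMap.range G.boundaryMap
  have hedge : ∀ e, G.endpointIndicator (G.tgt e) ∈ W ↔ G.endpointIndicator (G.src e) ∈ W := by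
    intro e
    have : G.endpointIndicator (G.tgt e) - G.endpointIndicator (G.src e) ∈ W :=
      ⟨_, boundaryMap_single e⟩
    constructor
    · intro h
      simpa using W.sub_mem h this
    · intro h
      simpa using W.add_mem this h
  have hv : ∀ e v, (G.src e = some v ∨ G.tgt e = some v) →
      (G.endpointIndicator (G.src e) ∈ W ↔ G.endpointIndicator (some v) ∈ W) := by
    rintro e v (h | h)
    · rw [h]
    · rw [← hedge, h]
  let p : G.Component → Prop := Quot.lift (fun e => G.endpointIndicator (G.src e) ∈ W) (by
    rintro e f ⟨v, h1, h2⟩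
    exact propext ((hv e v h1).trans (hv f v h2).symm))
  have h0 : p (G.componentOf e₀) := by
    change G.endpointIndicator (G.src e₀) ∈ W
    rw [h₀]
    convert W.zero_mem
    ext v
    simp [endpointIndicator]
  have hnode : ∀ v : G.Node, G.endpointIndicator (some v) ∈ W := by
    intro v
    obtain ⟨e, he⟩ := Finset.card_pos.1 (card_inEdges_pos v)
    rw [← hv e v (Or.inr (mem_inEdges.1 he))]
    change p (G.componentOf e)
    rw [hconn e]
    exact h0
  rw [eq_top_iff]
  intro d _
  have : d = ∑ v, d v • G.endpointIndicator (some v) := by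
    ext u
    simp [endpointIndicator, Finset.sum_apply]
  rw [this]
  exact W.sum_mem fun v _ => W.smul_mem _ (hnode v)

/-- On a connected graph with boundary there is a function on the edges whose inflow at each node
exceeds its outflow by the degree of the node. -/
theorem exists_potential {e₀ : G.Edge} (h₀ : G.src e₀ = none)
    (hconn : ∀ e, G.componentOf e = G.componentOf e₀) :
    ∃ c : G.Edge → ℕ, ∀ v, ∑ e ∈ G.inEdges v, c e = ∑ e ∈ G.outEdges v, c e + (G.inEdges v).card := by
  obtain ⟨c, hc⟩ := boundaryMap_surjective h₀ hconn fun v => ((G.inEdges v).card : ℤ)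
  -- Adding a constant to all edges keeps inflow minus outflow, as the degrees agree; `B` is large
  -- enough to make all values nonnegative.
  set B : ℕ := ∑ e, (c e).natAbs
  have hB : ∀ e, 0 ≤ c e + B := by
    intro e
    have : (c e).natAbs ≤ B :=
      Finset.single_le_sum (f := fun e => (c e).natAbs) (fun _ _ => Nat.zero_le _)
        (Finset.mem_univ e)
    omega
  refine ⟨fun e => (c e + B).toNat, fun v => ?_⟩
  have h1 := congrFun hc v
  simp only [boundaryMap, LinearMap.coe_mk, AddHom.coe_mk] at h1
  zify
  simp only [Int.toNat_of_nonneg (hB _), Finset.sum_add_distrib, Finset.sum_const]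
  rw [card_inEdges, card_outEdges] at *
  linarith

end Potential

/-! ### The non-local ideal over a base with parameter t. -/

section NonlocalSpan

variable {R : Type*} [CommRing R]

/-- The non-local relation of a set of nodes. -/
noncomputable def nonlocalGen (t : R) (Γ : Finset G.Node) : MvPolynomial G.Edge R :=
  C (t ^ G.floerWeight Γ) * (∏ e ∈ G.setOut Γ, X e) - ∏ e ∈ G.setIn Γ, X e

/-- The linear relation of a thick edge. -/
noncomputable def linearGen (t : R) (v : G.Node) : MvPolynomial G.Edge R :=
  (∑ e ∈ G.inEdges v, X e) - C t * ∑ e ∈ G.outEdges v, X e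

/-- The ideal generated by the non-local relations. -/
noncomputable def nonlocalSpan (t : R) : Ideal (MvPolynomial G.Edge R) :=
  Ideal.span (Set.range (G.nonlocalGen t))

variable {G} {S : Type*} [CommRing S] (f : R →+* S)

theorem map_nonlocalGen (t : R) (Γ : Finset G.Node) :
    map f (G.nonlocalGen t Γ) = G.nonlocalGen (f t) Γ := by
  simp [nonlocalGen, map_prod]

theorem map_linearGen (t : R) (v : G.Node) : map f (G.linearGen t v) = G.linearGen (f t) v := by
  simp [linearGen, map_sum]

theorem map_nonlocalSpan (t : R) :
    (G.nonlocalSpan t).map (map f : MvPolynomial G.Edge R →+* _) = G.nonlocalSpan (f t) := by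
  rw [nonlocalSpan, Ideal.map_span, ← Set.range_comp, nonlocalSpan]
  congr 2
  ext1 Γ
  exact map_nonlocalGen f t Γ

theorem prod_X_eq_monomial (s : Finset G.Edge) :
    (∏ e ∈ s, X e : MvPolynomial G.Edge R) = monomial (∑ e ∈ s, Finsupp.single e 1) 1 := by
  rw [monomial_sum_one]; rfl

theorem nonlocalGen_eq (t : R) (Γ : Finset G.Node) :
    G.nonlocalGen t Γ = monomial (∑ e ∈ G.setOut Γ, Finsupp.single e 1) (t ^ G.floerWeight Γ)
      - monomial (∑ e ∈ G.setIn Γ, Finsupp.single e 1) 1 := by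
  rw [nonlocalGen, prod_X_eq_monomial, prod_X_eq_monomial, C_mul_monomial, mul_one]

theorem linearGen_zero (v : G.Node) (k : Type*) [Field k] :
    G.linearGen (0 : k) v = G.inSum k v := by
  simp [linearGen, inSum]

theorem cutExponent_univ (Γ : Finset G.Node) :
    G.cutExponent Finset.univ Γ = ∑ e ∈ G.setIn Γ, Finsupp.single e 1 := by
  rw [cutExponent, Finset.univ_inter]

theorem nonlocalGen_empty (t : R) : G.nonlocalGen t ∅ = 0 := by
  simp [nonlocalGen, setIn, setOut, StartsIn, EndsIn, floerWeight]

/-- A nonempty set of nodes has positive weight, so at t = 0 only the product of entering edges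
remains. -/
theorem nonlocalSpan_zero (k : Type*) [Field k] :
    G.nonlocalSpan (0 : k) = G.cutIdeal k Finset.univ Finset.univ ∅ := by
  have h : ∀ Γ : Finset G.Node, Γ.Nonempty →
      G.nonlocalGen (0 : k) Γ = -monomial (G.cutExponent Finset.univ Γ) 1 := by
    intro Γ hΓ
    rw [nonlocalGen_eq, zero_pow (floerWeight_pos hΓ).ne', cutExponent_univ]
    simp
  apply le_antisymm
  · refine Ideal.span_le.2 ?_
    rintro _ ⟨Γ, rfl⟩
    rcases Γ.eq_empty_or_nonempty with rfl | hΓ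
    · rw [nonlocalGen_empty]
      exact Ideal.zero_mem _
    · rw [h Γ hΓ, SetLike.mem_coe, neg_mem_iff]
      exact Ideal.subset_span ⟨_, Or.inl ⟨Γ, hΓ, Finset.subset_univ _, rfl⟩, rfl⟩
  · refine Ideal.span_le.2 ?_
    rintro _ ⟨_, (⟨Γ, hΓ, -, rfl⟩ | ⟨z, hz, rfl⟩), rfl⟩
    · rw [SetLike.mem_coe, ← neg_mem_iff, ← h Γ hΓ]
      exact Ideal.subset_span ⟨Γ, rfl⟩
    · exact absurd hz (by simp)

end NonlocalSpan

/-! ### Standard monomials and absence of t-torsion. -/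

section NormalForm

variable {G}

/-- The exponents divisible by no cut monomial. -/
def IsStandard (a : G.Edge →₀ ℕ) : Prop :=
  ∀ Γ : Finset G.Node, Γ.Nonempty → ¬ G.cutExponent Finset.univ Γ ≤ a

variable (G) in
/-- Differences of the values of a function on the nodes, along the edges. -/
def gradient : (G.Node → ℤ) →+ (G.Edge → ℤ) where
  toFun h e := (G.src e).elim 0 h - (G.tgt e).elim 0 h
  map_zero' := by
    ext e; rcases G.src e with _ | u <;> rcases G.tgt e with _ | v <;> rfl
  map_add' g h := by
    ext e
    rcases hs : G.src e with _ | u <;> rcases ht : G.tgt e with _ | v <;>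
      simp [hs, ht] <;> ring

/-- Maximum principle: if `h` had a positive maximum, let `Γ` be the set where it is attained. An
edge entering `Γ` comes from a smaller value, or from the boundary where the value is 0, so its
gradient is negative and `b` is positive on it. Then the cut monomial of `Γ` divides `b`. -/
theorem IsStandard.nonpos_of_gradient {a b : G.Edge →₀ ℕ} (hb : IsStandard b) {h : G.Node → ℤ}
    (hab : ∀ e, (a e : ℤ) - b e = G.gradient h e) (v : G.Node) : h v ≤ 0 := by
  by_contra! hv
  obtain ⟨u, -, hu⟩ := Finset.exists_max_image Finset.univ h ⟨v, Finset.mem_univ v⟩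
  have hu0 : 0 < h u := hv.trans_le (hu v (Finset.mem_univ v))
  refine hb (Finset.univ.filter fun w => h w = h u) ⟨u, by simp⟩ fun e => ?_
  rw [cutExponent_apply]
  split_ifs with he
  · obtain ⟨h1, w, hw, ht⟩ := mem_setIn.1 he.2
    have h2 := hab e
    simp only [gradient, AddMonoidHom.coe_mk, ZeroHom.coe_mk, ht, Option.elim_some,
      (Finset.mem_filter.1 hw).2] at h2
    rcases hs : G.src e with _ | x
    · rw [hs, Option.elim_none] at h2
      omega
    · have h3 : h x ≠ h u := fun hx => h1 x (by simp [hx]) hs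
      have h4 := hu x (Finset.mem_univ x)
      rw [hs, Option.elim_some] at h2
      omega
  · exact Nat.zero_le _

theorem IsStandard.eq_of_gradient {a b : G.Edge →₀ ℕ} (ha : IsStandard a) (hb : IsStandard b)
    {h : G.Node → ℤ} (hab : ∀ e, (a e : ℤ) - b e = G.gradient h e) : a = b := by
  have h1 := hb.nonpos_of_gradient hab
  have h2 := ha.nonpos_of_gradient (a := b) (h := -h) (fun e => by
    rw [map_neg, Pi.neg_apply, ← hab]; ring)
  have h0 : h = 0 := by
    ext v
    have := h2 v
    rw [Pi.neg_apply] at this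
    exact le_antisymm (h1 v) (by simpa using this)
  ext e
  have := hab e
  rw [h0, map_zero, Pi.zero_apply] at this
  omega

variable (G) in
/-- The class of an exponent modulo gradients. -/
def gradientClass (a : G.Edge →₀ ℕ) : (G.Edge → ℤ) ⧸ G.gradient.range :=
  QuotientAddGroup.mk fun e => (a e : ℤ)

theorem IsStandard.eq_of_gradientClass_eq {a b : G.Edge →₀ ℕ} (ha : IsStandard a)
    (hb : IsStandard b) (hab : G.gradientClass a = G.gradientClass b) : a = b := by
  obtain ⟨h, hh⟩ := QuotientAddGroup.eq.1 hab
  refine (hb.eq_of_gradient ha (h := h) fun e => ?_).symm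
  rw [hh]
  simp only [Pi.add_apply, Pi.neg_apply]
  ring

/-- The two exponents differ by the gradient of the indicator function of `Γ`. -/
theorem gradientClass_add_setOut (b : G.Edge →₀ ℕ) (Γ : Finset G.Node) :
    G.gradientClass (b + ∑ e ∈ G.setOut Γ, Finsupp.single e 1) =
      G.gradientClass (b + ∑ e ∈ G.setIn Γ, Finsupp.single e 1) := by
  refine (QuotientAddGroup.eq.2 (AddMonoidHom.mem_range.2
    ⟨fun v => if v ∈ Γ then 1 else 0, ?_⟩)).symm
  ext e
  simp only [gradient, AddMonoidHom.coe_mk, ZeroHom.coe_mk, Pi.add_apply, Pi.neg_apply,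
    Finsupp.add_apply, Finsupp.finsetSum_apply, Finsupp.single_apply, Finset.sum_ite_eq',
    mem_setIn, mem_setOut]
  rcases hs : G.src e with _ | u <;> rcases ht : G.tgt e with _ | v <;>
    simp <;> split_ifs <;> grind

/-- The total potential of an exponent. -/
def potential (c : G.Edge → ℕ) (a : G.Edge →₀ ℕ) : ℕ := ∑ e, a e * c e

theorem potential_add (c : G.Edge → ℕ) (a b : G.Edge →₀ ℕ) :
    potential c (a + b) = potential c a + potential c b := by
  simp [potential, add_mul, Finset.sum_add_distrib]

theorem potential_sum_single (c : G.Edge → ℕ) (s : Finset G.Edge) :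
    potential c (∑ e ∈ s, Finsupp.single e 1) = ∑ e ∈ s, c e := by
  simp [potential, Finsupp.finsetSum_apply, Finsupp.single_apply]

variable {c : G.Edge → ℕ}

/-- The potential gap equals the exponent of t in the relation of `Γ`. Its positivity makes
rewriting terminate; its exact value makes `classSum` kill the relation. -/
theorem sum_setIn_eq (hc : ∀ v, ∑ e ∈ G.inEdges v, c e = ∑ e ∈ G.outEdges v, c e + (G.inEdges v).card)
    (Γ : Finset G.Node) : ∑ e ∈ G.setIn Γ, c e = ∑ e ∈ G.setOut Γ, c e + G.floerWeight Γ := by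
  have h1 := sum_inEdges c Γ
  have h2 := sum_outEdges c Γ
  simp only [hc, Finset.sum_add_distrib, ← floerWeight_eq_sum] at h1
  omega

variable {R : Type*} [CommRing R]

/-- Modulo the non-local relations every monomial is a multiple of a standard one. -/
theorem exists_standard_monomial
    (hc : ∀ v, ∑ e ∈ G.inEdges v, c e = ∑ e ∈ G.outEdges v, c e + (G.inEdges v).card) (t : R) :
    ∀ (N : ℕ) (a : G.Edge →₀ ℕ) (r : R), potential c a = N →
      ∃ b s, IsStandard b ∧ monomial a r - monomial b s ∈ G.nonlocalSpan t := by
  intro N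
  induction N using Nat.strong_induction_on with
  | _ N ih =>
    intro a r ha
    by_cases hst : IsStandard a
    · exact ⟨a, r, hst, by simp⟩
    · simp only [IsStandard, not_forall, not_not] at hst
      obtain ⟨Γ, hΓ, hle⟩ := hst
      rw [cutExponent_univ] at hle
      obtain ⟨d, rfl⟩ := exists_add_of_le hle
      have h1 := sum_setIn_eq hc Γ
      have h2 := floerWeight_pos hΓ
      rw [potential_add, potential_sum_single] at ha
      -- Trading the entering edges of `Γ` for the leaving ones lowers the potential by the positive
      -- weight of `Γ`.
      obtain ⟨b, s, hb, hbs⟩ := ih (potential c (∑ e ∈ G.setOut Γ, Finsupp.single e 1 + d))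
        (by rw [potential_add, potential_sum_single]; omega) _ (t ^ G.floerWeight Γ * r) rfl
      refine ⟨b, s, hb, ?_⟩
      have h3 : monomial d r * G.nonlocalGen t Γ ∈ G.nonlocalSpan t :=
        Ideal.mul_mem_left _ _ (Ideal.subset_span ⟨Γ, rfl⟩)
      have := Ideal.sub_mem _ hbs h3
      rw [nonlocalGen_eq, mul_sub, monomial_mul, monomial_mul, mul_one, add_comm d, add_comm d,
        mul_comm r] at this
      convert this using 1
      ring

theorem exists_standard
    (hc : ∀ v, ∑ e ∈ G.inEdges v, c e = ∑ e ∈ G.outEdges v, c e + (G.inEdges v).card) (t : R)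
    (f : MvPolynomial G.Edge R) :
    ∃ g, f - g ∈ G.nonlocalSpan t ∧ ∀ a ∈ g.support, IsStandard a := by
  induction f using MvPolynomial.induction_on' with
  | monomial a r =>
    obtain ⟨b, s, hb, h⟩ := exists_standard_monomial hc t _ a r rfl
    refine ⟨_, h, fun a ha => ?_⟩
    rw [Finset.mem_singleton.1 (support_monomial_subset ha)]
    exact hb
  | add p q hp hq =>
    obtain ⟨g, hg, hg'⟩ := hp
    obtain ⟨h, hh, hh'⟩ := hq
    refine ⟨g + h, by convert Ideal.add_mem _ hg hh using 1; ring, fun a ha => ?_⟩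
    classical
    rcases Finset.mem_union.1 (support_add ha) with ha | ha
    · exact hg' a ha
    · exact hh' a ha

/-- The coefficientwise evaluation of a polynomial in the classes of exponents modulo gradients. -/
noncomputable def classSum (c : G.Edge → ℕ) (t : R) :
    MvPolynomial G.Edge R →ₗ[R] ((G.Edge → ℤ) ⧸ G.gradient.range) →₀ R :=
  (basisMonomials G.Edge R).constr R fun a => Finsupp.single (G.gradientClass a) (t ^ potential c a)

theorem classSum_monomial (t : R) (a : G.Edge →₀ ℕ) (r : R) :
    classSum c t (monomial a r) = Finsupp.single (G.gradientClass a) (r * t ^ potential c a) := by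
  have h : monomial a r = r • basisMonomials G.Edge R a := by simp [smul_monomial]
  rw [h, map_smul, classSum, Module.Basis.constr_basis, Finsupp.smul_single, smul_eq_mul]

theorem classSum_eq_zero_of_mem
    (hc : ∀ v, ∑ e ∈ G.inEdges v, c e = ∑ e ∈ G.outEdges v, c e + (G.inEdges v).card) {t : R}
    {f : MvPolynomial G.Edge R} (hf : f ∈ G.nonlocalSpan t) : classSum c t f = 0 := by
  -- `classSum` is only linear over the base, so the claim is strengthened to all multiples `g * f`
  -- before the induction.
  refine Submodule.span_induction (p := fun f _ => ∀ g, classSum c t (g * f) = 0) ?_ ?_ ?_ ?_ hf 1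
    |> fun h => by simpa using h
  · rintro _ ⟨Γ, rfl⟩ g
    induction g using MvPolynomial.induction_on' with
    | monomial a r =>
      rw [nonlocalGen_eq, mul_sub, monomial_mul, monomial_mul, map_sub, classSum_monomial,
        classSum_monomial, gradientClass_add_setOut, potential_add, potential_add,
        potential_sum_single, potential_sum_single, sum_setIn_eq hc, sub_eq_zero]
      congr 1
      ring
    | add p q hp hq => rw [add_mul, map_add, hp, hq, add_zero]
  · simp
  · intro p q _ _ hp hq g
    rw [mul_add, map_add, hp, hq, add_zero]
  · intro a p _ hp g
    rw [smul_eq_mul, ← mul_assoc]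
    exact hp _

/-- Distinct standard monomials lie in distinct classes, so each coefficient can be read off up to a
nonzero power of `t`. -/
theorem eq_zero_of_classSum_eq_zero [IsDomain R] {t : R} (ht : t ≠ 0) {g : MvPolynomial G.Edge R}
    (hg : ∀ a ∈ g.support, IsStandard a) (h : classSum c t g = 0) : g = 0 := by
  by_contra hne
  obtain ⟨a, ha⟩ := support_nonempty.2 hne
  have h1 := DFunLike.congr_fun h (G.gradientClass a)
  rw [g.as_sum, map_sum, Finsupp.finsetSum_apply, Finset.sum_eq_single a] at h1
  · rw [classSum_monomial, Finsupp.single_eq_same, Finsupp.zero_apply] at h1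
    exact mul_ne_zero (mem_support_iff.1 ha) (pow_ne_zero _ ht) h1
  · intro b hb hba
    rw [classSum_monomial, Finsupp.single_eq_of_ne]
    exact fun h2 => hba ((hg b hb).eq_of_gradientClass_eq (hg a ha) h2.symm)
  · exact fun h2 => absurd ha h2

/-- This exhibits the quotient as a submodule of a free module over a domain, hence torsion-free. -/
theorem mem_nonlocalSpan_iff [IsDomain R]
    (hc : ∀ v, ∑ e ∈ G.inEdges v, c e = ∑ e ∈ G.outEdges v, c e + (G.inEdges v).card) {t : R}
    (ht : t ≠ 0) {f : MvPolynomial G.Edge R} : f ∈ G.nonlocalSpan t ↔ classSum c t f = 0 := by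
  refine ⟨classSum_eq_zero_of_mem hc, fun h => ?_⟩
  obtain ⟨g, hg, hg'⟩ := exists_standard hc t f
  have h1 := classSum_eq_zero_of_mem hc hg
  rw [map_sub, h, zero_sub, neg_eq_zero] at h1
  rw [eq_zero_of_classSum_eq_zero ht hg' h1, sub_zero] at hg
  exact hg

/-- On a connected graph the non-local relations generate a saturated ideal. -/
theorem mem_nonlocalSpan_of_C_mul_mem [IsDomain R]
    (hc : ∀ v, ∑ e ∈ G.inEdges v, c e = ∑ e ∈ G.outEdges v, c e + (G.inEdges v).card) {t : R}
    (ht : t ≠ 0) {f : MvPolynomial G.Edge R} (hf : C t * f ∈ G.nonlocalSpan t) :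
    f ∈ G.nonlocalSpan t := by
  rw [mem_nonlocalSpan_iff hc ht] at hf ⊢
  rw [C_mul', map_smul] at hf
  ext q
  have := DFunLike.congr_fun hf q
  rw [Finsupp.smul_apply, smul_eq_mul, Finsupp.zero_apply] at this
  exact (mul_eq_zero.1 this).resolve_left ht

end NormalForm

end TrivalentGraph

/-! ### Lifting regularity from the special fibre. -/

section Degeneration

open MvPolynomial

attribute [local instance] MvPolynomial.gradedAlgebra

variable {σ R : Type*} [CommRing R]

/-- A homogeneous ideal in finitely many variables over a Noetherian local ring is closed in the
adic topology of any proper element of the base. -/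
theorem mem_of_forall_mem_sup_span_C_pow [Finite σ] [IsNoetherianRing R] [IsLocalRing R] {t : R}
    (ht : ¬IsUnit t) {I : Ideal (MvPolynomial σ R)} (hI : I.IsHomogeneous (homogeneousSubmodule σ R))
    {f : MvPolynomial σ R} (hf : ∀ n : ℕ, f ∈ I ⊔ Ideal.span {C t ^ n}) : f ∈ I := by
  set d := f.totalDegree
  let W := restrictTotalDegree σ R d
  let K : Submodule R W := (I.restrictScalars R).comap W.subtype
  -- Truncation to degree at most `d` preserves the homogeneous ideal `I` and reduces the claim to
  -- the finitely generated module `W ⧸ K`, where Krull's intersection theorem applies.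
  let trunc : MvPolynomial σ R →ₗ[R] MvPolynomial σ R :=
    ∑ i ∈ Finset.range (d + 1), homogeneousComponent i
  have htrunc : ∀ p, trunc p ∈ W := by
    intro p
    rw [mem_restrictTotalDegree, LinearMap.sum_apply]
    refine (totalDegree_finsetSum _ _).trans (Finset.sup_le fun i hi => ?_)
    exact (homogeneousComponent_isHomogeneous i p).totalDegree_le.trans
      (Nat.lt_succ_iff.1 (Finset.mem_range.1 hi))
  have hf0 : trunc f = f := by
    rw [LinearMap.sum_apply]
    exact sum_homogeneousComponent f
  have hfW : f ∈ W := hf0 ▸ htrunc f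
  have htI : ∀ p ∈ I, trunc p ∈ I := by
    intro p hp
    rw [LinearMap.sum_apply]
    exact Ideal.sum_mem _ fun i _ => homogeneousComponent_mem_of_mem hI hp i
  have hne : Ideal.span {t} ≠ ⊤ := by rwa [Ne, Ideal.span_singleton_eq_top]
  have key := Ideal.iInf_pow_smul_eq_bot_of_isLocalRing (M := W ⧸ K) _ hne
  have hmem : (Submodule.Quotient.mk ⟨f, hfW⟩ : W ⧸ K) ∈
      (⨅ i : ℕ, Ideal.span {t} ^ i • ⊤ : Submodule R (W ⧸ K)) := by
    rw [Submodule.mem_iInf]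
    intro n
    obtain ⟨g, hg⟩ := IsRegularMod.mem_sup_span_singleton.1 (hf n)
    have h1 := htI _ hg
    rw [map_sub, hf0, ← C_pow, C_mul', map_smul] at h1
    have h2 : (Submodule.Quotient.mk ⟨f, hfW⟩ : W ⧸ K) =
        t ^ n • Submodule.Quotient.mk ⟨trunc g, htrunc g⟩ := by
      rw [← Submodule.Quotient.mk_smul, Submodule.Quotient.eq]
      exact h1
    rw [h2]
    exact Submodule.smul_mem_smul (Ideal.pow_mem_pow (Ideal.mem_span_singleton_self t) n) trivial
  rw [key, Submodule.mem_bot, Submodule.Quotient.mk_eq_zero] at hmem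
  exact hmem

/-- A sequence that is regular on the special fibre of a flat homogeneous family is regular on the
total space. -/
theorem IsRegularMod.of_map [Finite σ] [IsNoetherianRing R] [IsLocalRing R] {t : R}
    (ht : ¬IsUnit t) {k : Type*} [CommRing k] {π : R →+* k} (hπ : Function.Surjective π)
    (hker : RingHom.ker π = Ideal.span {t}) :
    ∀ {l : List (MvPolynomial σ R)} {I : Ideal (MvPolynomial σ R)},
      I.IsHomogeneous (homogeneousSubmodule σ R) →
      (∀ a ∈ l, ∃ i, a.IsHomogeneous i) →
      (∀ f, C t * f ∈ I → f ∈ I) →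
      IsRegularMod (I.map (map π : MvPolynomial σ R →+* _)) (l.map (map π)) → IsRegularMod I l
  | [], _, _, _, _, _ => trivial
  | a :: l, I, hI, hl, htI, h => by
    have hk : RingHom.ker (map π : MvPolynomial σ R →+* _) = Ideal.span {C t} := by
      rw [ker_map, hker, Ideal.map_span, Set.image_singleton]
    have hmap : ∀ f, map π f ∈ I.map (map π : MvPolynomial σ R →+* _) ↔
        f ∈ I ⊔ Ideal.span {C t} := by
      intro f
      rw [← Ideal.mem_comap, Ideal.comap_map_of_surjective _ (map_surjective π hπ),
        ← RingHom.ker_eq_comap_bot, hk]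
    have hdiv : ∀ f, a * f ∈ I → ∃ g, f - C t * g ∈ I ∧ a * g ∈ I := by
      intro f hf
      have h1 := h.1 (map π f) (by rw [← map_mul]; exact Ideal.mem_map_of_mem _ hf)
      obtain ⟨g, hg⟩ := mem_sup_span_singleton.1 ((hmap f).1 h1)
      refine ⟨g, hg, htI _ ?_⟩
      have := Ideal.sub_mem _ hf (Ideal.mul_mem_left _ a hg)
      convert this using 1; ring
    have hreg : ∀ f, a * f ∈ I → f ∈ I := by
      intro f hf
      -- Iterating `hdiv` writes `f` modulo `I` as a multiple of every power of `t`.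
      refine mem_of_forall_mem_sup_span_C_pow ht hI fun n => ?_
      induction n generalizing f with
      | zero => simp
      | succ n ih =>
        obtain ⟨g, hg, hag⟩ := hdiv f hf
        obtain ⟨g', hg'⟩ := mem_sup_span_singleton.1 (ih g hag)
        refine mem_sup_span_singleton.2 ⟨g', ?_⟩
        have := Ideal.add_mem _ hg (Ideal.mul_mem_left _ (C t) hg')
        convert this using 1; ring
    refine ⟨hreg, of_map ht hπ hker ?_ (fun b hb => hl b (List.mem_cons_of_mem _ hb)) ?_ ?_⟩
    · obtain ⟨i, hi⟩ := hl a List.mem_cons_self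
      refine hI.sup (Ideal.homogeneous_span _ _ ?_)
      rintro _ rfl
      exact ⟨i, hi⟩
    -- `I + (a)` is again saturated: if `t f ≡ a g` modulo `I`, regularity of `a` on the fibre gives
    -- `g ≡ t g'`, and saturation of `I` cancels `t` from `t (f - a g')`.
    · intro f hf
      obtain ⟨g, hg⟩ := mem_sup_span_singleton.1 hf
      have h1 : map π g ∈ I.map (map π : MvPolynomial σ R →+* _) := by
        refine h.1 _ ?_
        rw [← map_mul, hmap]
        refine mem_sup_span_singleton.2 ⟨f, ?_⟩
        rw [← neg_mem_iff]
        convert hg using 1; ring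
      obtain ⟨g', hg'⟩ := mem_sup_span_singleton.1 ((hmap g).1 h1)
      refine mem_sup_span_singleton.2 ⟨g', htI _ ?_⟩
      have := Ideal.add_mem _ hg (Ideal.mul_mem_left _ a hg')
      convert this using 1; ring
    · have := h.2
      rw [Ideal.map_sup, Ideal.map_span, Set.image_singleton]
      exact this

/-- Weak regularity is preserved by localization. -/
theorem IsRegularMod.localization {A B : Type*} [CommRing A] [CommRing B] [Algebra A B]
    (M : Submonoid A) [IsLocalization M B] : ∀ {l : List A} {I : Ideal A}, IsRegularMod I l →
      IsRegularMod (I.map (algebraMap A B)) (l.map (algebraMap A B))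
  | [], _, _ => trivial
  | a :: l, I, h => by
    refine ⟨fun f hf => ?_, ?_⟩
    · obtain ⟨f, s, rfl⟩ := IsLocalization.exists_mk'_eq M f
      rw [← IsLocalization.mk'_one (M := M) B a, ← IsLocalization.mk'_mul,
        IsLocalization.mk'_mem_map_algebraMap_iff] at hf
      obtain ⟨m, hm, hmf⟩ := hf
      refine (IsLocalization.mk'_mem_map_algebraMap_iff M B I f s).2 ⟨m, hm, h.1 _ ?_⟩
      convert hmf using 1; ring
    · have := localization (B := B) M h.2
      rwa [Ideal.map_sup, Ideal.map_span, Set.image_singleton] at this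

end Degeneration

/-! ### Regularity of the linear relations over Laurent series. -/

namespace TrivalentGraph

open MvPolynomial

variable (G : TrivalentGraph) (𝕜 : Type*) [Field 𝕜]

attribute [local instance] MvPolynomial.gradedAlgebra MvPolynomial.algebraMvPolynomial

variable {G}

theorem isHomogeneous_nonlocalSpan {R : Type*} [CommRing R] (t : R) :
    (G.nonlocalSpan t).IsHomogeneous (homogeneousSubmodule G.Edge R) := by
  refine Ideal.homogeneous_span _ _ ?_
  rintro _ ⟨Γ, rfl⟩
  have hprod : ∀ s : Finset G.Edge, (∏ e ∈ s, X e : MvPolynomial G.Edge R).IsHomogeneous s.card := by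
    intro s
    have := IsHomogeneous.prod s (fun e => (X e : MvPolynomial G.Edge R)) (fun _ => 1)
      (fun e _ => isHomogeneous_X R e)
    simpa using this
  refine ⟨(G.setIn Γ).card, ?_⟩
  have h := hprod (G.setOut Γ)
  rw [card_setOut_eq] at h
  have := (isHomogeneous_C G.Edge (t ^ G.floerWeight Γ)).mul h
  rw [zero_add] at this
  exact this.sub (hprod _)

theorem isHomogeneous_linearGen {R : Type*} [CommRing R] (t : R) (v : G.Node) :
    (G.linearGen t v).IsHomogeneous 1 := by
  refine (IsHomogeneous.sum _ _ _ fun e _ => isHomogeneous_X R e).sub ?_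
  have := (isHomogeneous_C G.Edge t).mul
    (IsHomogeneous.sum (G.outEdges v) _ 1 fun e _ => isHomogeneous_X R e)
  rwa [zero_add] at this

theorem tpow_one_eq : tpow 𝕜 1 = algebraMap (PowerSeries 𝕜) (LaurentSeries 𝕜) PowerSeries.X := by
  rw [LaurentSeries.coe_algebraMap, HahnSeries.ofPowerSeries_X, tpow]

variable {𝕜}

/-- The degeneration argument for any saturated homogeneous family whose fibre is a cut ideal. It is
needed twice, for the zero ideal (empty `F` and `D`) and for the non-local ideal (full `F` and `D`).
-/
theorem isRegularMod_map_linearGen {I : Ideal (MvPolynomial G.Edge (PowerSeries 𝕜))}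
    (hI : I.IsHomogeneous (homogeneousSubmodule G.Edge (PowerSeries 𝕜)))
    (ht : ∀ f, C PowerSeries.X * f ∈ I → f ∈ I) (F : Finset G.Edge) (D : Finset G.Node)
    (hcut : I.map (map PowerSeries.constantCoeff : MvPolynomial G.Edge (PowerSeries 𝕜) →+* _) =
      G.cutIdeal 𝕜 F D ∅)
    {l : List G.Node} (hl : l.Nodup) (hlt : ∀ v ∈ l, G.isThick v = true) :
    IsRegularMod (I.map (map (algebraMap (PowerSeries 𝕜) (LaurentSeries 𝕜)) :
      MvPolynomial G.Edge (PowerSeries 𝕜) →+* _)) (l.map (G.linearGen (tpow 𝕜 1))) := by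
  have h : IsRegularMod I (l.map (G.linearGen (PowerSeries.X : PowerSeries 𝕜))) := by
    refine IsRegularMod.of_map (t := PowerSeries.X) (π := PowerSeries.constantCoeff) ?_ ?_ ?_ hI ?_
      ht ?_
    · rw [PowerSeries.isUnit_iff_constantCoeff]; simp
    · exact fun a => ⟨PowerSeries.C a, by simp⟩
    · ext p
      rw [RingHom.mem_ker, Ideal.mem_span_singleton, PowerSeries.X_dvd_iff]
    · intro a ha
      obtain ⟨v, -, rfl⟩ := List.mem_map.1 ha
      exact ⟨1, isHomogeneous_linearGen _ v⟩
    · rw [hcut, List.map_map]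
      convert isRegularMod_cutIdeal 𝕜 hl hlt F D using 2
      ext1 v
      rw [Function.comp_apply, map_linearGen, PowerSeries.constantCoeff_X, linearGen_zero]
  -- Laurent series are power series with t inverted, and the same holds for polynomials over them.
  have := h.localization (B := MvPolynomial G.Edge (LaurentSeries 𝕜))
    ((Submonoid.powers (PowerSeries.X : PowerSeries 𝕜)).map (C (σ := G.Edge)))
  have hgen : ⇑(algebraMap (MvPolynomial G.Edge (PowerSeries 𝕜))
      (MvPolynomial G.Edge (LaurentSeries 𝕜))) ∘ G.linearGen PowerSeries.X =
      G.linearGen (tpow 𝕜 1) := by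
    ext1 v
    rw [Function.comp_apply, algebraMap_def, map_linearGen, tpow_one_eq]
  rw [List.map_map, hgen] at this
  exact this

/-- The linear relations form a regular sequence on the edge ring. -/
theorem isRegularMod_bot_linearGen {l : List G.Node} (hl : l.Nodup)
    (hlt : ∀ v ∈ l, G.isThick v = true) :
    IsRegularMod ⊥ (l.map (G.linearGen (tpow 𝕜 1))) := by
  have := isRegularMod_map_linearGen (G := G) (𝕜 := 𝕜) (I := ⊥) (Ideal.IsHomogeneous.bot _) ?_ ∅ ∅
    ?_ hl hlt
  · rwa [Ideal.map_bot] at this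
  · intro f hf
    rw [Ideal.mem_bot] at hf ⊢
    refine (mul_eq_zero.1 hf).resolve_left ?_
    rw [C_eq_zero]
    exact PowerSeries.X_ne_zero
  · rw [Ideal.map_bot, eq_comm, eq_bot_iff, cutIdeal, Ideal.span_le]
    rintro _ ⟨_, (⟨Γ, hΓ, hΓD, rfl⟩ | ⟨z, hz, rfl⟩), rfl⟩
    · exact absurd hΓ (by simp [Finset.subset_empty.1 hΓD])
    · exact absurd hz (by simp)

/-- On a connected graph with boundary the linear relations form a regular sequence modulo the
non-local ideal. -/
theorem isRegularMod_nonlocalSpan_linearGen {e₀ : G.Edge} (h₀ : G.src e₀ = none)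
    (hconn : ∀ e, G.componentOf e = G.componentOf e₀) {l : List G.Node} (hl : l.Nodup)
    (hlt : ∀ v ∈ l, G.isThick v = true) :
    IsRegularMod (G.nonlocalSpan (tpow 𝕜 1)) (l.map (G.linearGen (tpow 𝕜 1))) := by
  obtain ⟨c, hc⟩ := exists_potential h₀ hconn
  have := isRegularMod_map_linearGen (G := G) (𝕜 := 𝕜) (isHomogeneous_nonlocalSpan PowerSeries.X)
    (fun f => mem_nonlocalSpan_of_C_mul_mem hc PowerSeries.X_ne_zero) Finset.univ Finset.univ
    (by rw [map_nonlocalSpan, PowerSeries.constantCoeff_X, nonlocalSpan_zero]) hl hlt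
  rwa [map_nonlocalSpan, ← tpow_one_eq] at this

end TrivalentGraph

/-! ### Mapping cones and vanishing of Tor. -/

section TorVanishing

open TensorProduct

universe u

section Cone

variable {R : Type*} [CommRing R] {W X Y Z : Type*} [AddCommGroup W] [AddCommGroup X]
  [AddCommGroup Y] [AddCommGroup Z] [Module R W] [Module R X] [Module R Y] [Module R Z]

/-- The differential of the mapping cone of multiplication by `a` on a complex. -/
def coneMap (a : R) (f : X →ₗ[R] Y) (g : Y →ₗ[R] Z) : X × Y →ₗ[R] Y × Z :=
  (f.coprod (a • LinearMap.id)).prod (-(g ∘ₗ LinearMap.snd R X Y))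

/-- The last differential of the mapping cone of multiplication by `a` on a complex. -/
def coneMapZero (a : R) (g : Y →ₗ[R] Z) : Y × Z →ₗ[R] Z := g.coprod (a • LinearMap.id)

theorem coneMap_apply (a : R) (f : X →ₗ[R] Y) (g : Y →ₗ[R] Z) (p : X × Y) :
    coneMap a f g p = (f p.1 + a • p.2, -g p.2) := rfl

theorem coneMapZero_apply (a : R) (g : Y →ₗ[R] Z) (p : Y × Z) :
    coneMapZero a g p = g p.1 + a • p.2 := rfl

variable {f : W →ₗ[R] X} {g : X →ₗ[R] Y} {h : Y →ₗ[R] Z}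

theorem exact_coneMap (a : R) (hfg : Function.Exact f g) (hgh : Function.Exact g h) :
    Function.Exact (coneMap a f g) (coneMap a g h) := by
  rintro ⟨x, y⟩
  rw [coneMap_apply, Prod.mk_eq_zero, neg_eq_zero]
  constructor
  · rintro ⟨h1, h2⟩
    obtain ⟨z, rfl⟩ := (hgh y).1 h2
    dsimp only at h1
    rw [← map_smul, ← map_add] at h1
    obtain ⟨w, hw⟩ := (hfg _).1 h1
    refine ⟨(w, -z), ?_⟩
    rw [coneMap_apply, hw]
    simp
  · rintro ⟨⟨w, z⟩, hp⟩
    rw [coneMap_apply, Prod.mk.injEq] at hp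
    obtain ⟨rfl, rfl⟩ := hp
    dsimp only
    rw [map_neg, hgh.apply_apply_eq_zero, map_add, hfg.apply_apply_eq_zero, map_smul]
    simp

/-- At the bottom of the cone, exactness is injectivity of `a` on the cokernel of `g`. -/
theorem exact_coneMapZero {a : R} (hfg : Function.Exact f g)
    (ha : ∀ y, a • y ∈ LinearMap.range g → y ∈ LinearMap.range g) :
    Function.Exact (coneMap a f g) (coneMapZero a g) := by
  rintro ⟨x, y⟩
  rw [coneMapZero_apply]
  constructor
  · intro h1
    dsimp only at h1
    obtain ⟨z, rfl⟩ := ha y ⟨-x, by rw [map_neg, neg_eq_iff_add_eq_zero]; exact h1⟩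
    rw [← map_smul, ← map_add] at h1
    obtain ⟨w, hw⟩ := (hfg _).1 h1
    refine ⟨(w, -z), ?_⟩
    rw [coneMap_apply, hw]
    simp
  · rintro ⟨⟨w, z⟩, hp⟩
    rw [coneMap_apply, Prod.mk.injEq] at hp
    obtain ⟨rfl, rfl⟩ := hp
    dsimp only
    rw [map_add, hfg.apply_apply_eq_zero, map_smul]
    simp

variable (M : Type*) [AddCommGroup M] [Module R M]

/-- Tensoring commutes with forming the cone, so the same exactness lemmas serve before and after
tensoring. -/
theorem rTensor_coneMap (a : R) (f : W →ₗ[R] X) (g : X →ₗ[R] Y) :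
    coneMap a (f.rTensor M) (g.rTensor M) ∘ₗ (prodLeft R R W X M).toLinearMap =
      (prodLeft R R X Y M).toLinearMap ∘ₗ (coneMap a f g).rTensor M := by
  refine TensorProduct.ext' fun ⟨x, y⟩ m => ?_
  simp [coneMap_apply, add_tmul, neg_tmul, smul_tmul']

theorem rTensor_coneMapZero (a : R) (f : W →ₗ[R] X) :
    coneMapZero a (f.rTensor M) ∘ₗ (prodLeft R R W X M).toLinearMap =
      (LinearEquiv.refl R (X ⊗[R] M)).toLinearMap ∘ₗ (coneMapZero a f).rTensor M := by
  refine TensorProduct.ext' fun ⟨x, y⟩ m => ?_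
  simp [coneMapZero_apply, add_tmul, smul_tmul']

end Cone

theorem Ideal.Quotient.algHom_eq {R B : Type*} [CommRing R] [CommRing B] [Algebra R B] {I : Ideal R}
    (f g : R ⧸ I →ₐ[R] B) : f = g := by
  refine AlgHom.ext fun x => ?_
  obtain ⟨r, rfl⟩ := Ideal.Quotient.mk_surjective x
  exact (f.commutes r).trans (g.commutes r).symm

/-- The tensor product of two cyclic algebras. -/
noncomputable def quotientTensorQuotientSupEquiv {R : Type*} [CommRing R] (I N : Ideal R) :
    (R ⧸ I) ⊗[R] (R ⧸ N) ≃ₐ[R] R ⧸ (I ⊔ N) :=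
  AlgEquiv.ofAlgHom
    (Algebra.TensorProduct.lift (Ideal.Quotient.factorₐ R le_sup_left)
      (Ideal.Quotient.factorₐ R le_sup_right) fun _ _ => mul_comm _ _)
    (Ideal.Quotient.liftₐ (I ⊔ N) (Algebra.ofId R _) (by
      intro a ha
      have : I ⊔ N ≤ RingHom.ker (Algebra.ofId R ((R ⧸ I) ⊗[R] (R ⧸ N))) := by
        refine sup_le (fun b hb => ?_) fun b hb => ?_
        · rw [RingHom.mem_ker, Algebra.ofId_apply, Algebra.TensorProduct.algebraMap_apply,
            Ideal.Quotient.algebraMap_eq, Ideal.Quotient.eq_zero_iff_mem.2 hb, zero_tmul]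
        · rw [RingHom.mem_ker, Algebra.ofId_apply, Algebra.TensorProduct.algebraMap_apply',
            Ideal.Quotient.algebraMap_eq, Ideal.Quotient.eq_zero_iff_mem.2 hb, tmul_zero]
      exact this ha))
    (Ideal.Quotient.algHom_eq _ _)
    (Algebra.TensorProduct.ext (Ideal.Quotient.algHom_eq _ _) (Ideal.Quotient.algHom_eq _ _))

/-- `R ⧸ I` has a projective resolution that stays exact after tensoring with `R ⧸ N`. -/
def HasTorAcyclicResolution {R : Type u} [CommRing R] (I N : Ideal R) : Prop :=
  ∃ (C : ℕ → ModuleCat.{u} R) (d : ∀ n, C (n + 1) →ₗ[R] C n) (ε : C 0 →ₗ[R] R ⧸ I),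
    (∀ n, Module.Projective R (C n)) ∧ Function.Surjective ε ∧ Function.Exact (d 0) ε ∧
      (∀ n, Function.Exact (d (n + 1)) (d n)) ∧
      ∀ n, Function.Exact ((d (n + 1)).rTensor (R ⧸ N)) ((d n).rTensor (R ⧸ N))

variable {R : Type u} [CommRing R]

theorem hasTorAcyclicResolution_bot (N : Ideal R) : HasTorAcyclicResolution ⊥ N := by
  refine ⟨fun n => match n with
    | 0 => ModuleCat.of R R
    | _ + 1 => ModuleCat.of R PUnit.{u + 1}, fun _ => 0, (Ideal.Quotient.mkₐ R ⊥).toLinearMap, ?_,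
    Ideal.Quotient.mk_surjective, ?_, ?_, ?_⟩
  · rintro (_ | n)
    · exact inferInstanceAs (Module.Projective R R)
    · exact inferInstanceAs (Module.Projective R PUnit.{u + 1})
  · intro x
    constructor
    · intro h
      exact ⟨0, (Ideal.mem_bot.1 (Ideal.Quotient.eq_zero_iff_mem.1 h)).symm⟩
    · rintro ⟨y, rfl⟩
      exact map_zero _
  · intro n x
    exact ⟨fun _ => ⟨0, Subsingleton.elim (α := PUnit) _ _⟩, fun _ => rfl⟩
  · intro n x
    have : Subsingleton (PUnit.{u + 1} ⊗[R] (R ⧸ N)) := inferInstance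
    exact ⟨fun _ => ⟨0, this.elim _ _⟩, fun _ => by rw [LinearMap.rTensor_zero]; rfl⟩

/-- The new resolution is the cone of multiplication by `a` on the old one. The two hypotheses say
that `a` is injective on its zeroth homology, `R ⧸ I` before tensoring and `R ⧸ (I ⊔ N)` after. -/
theorem HasTorAcyclicResolution.sup_span_singleton {I N : Ideal R} {a : R}
    (hI : ∀ f, a * f ∈ I → f ∈ I) (hIN : ∀ f, a * f ∈ I ⊔ N → f ∈ I ⊔ N)
    (h : HasTorAcyclicResolution I N) : HasTorAcyclicResolution (I ⊔ Ideal.span {a}) N := by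
  obtain ⟨C, d, ε, hproj, hε, h0, hd, hdt⟩ := h
  have hreg : ∀ y, a • y ∈ LinearMap.range (d 0) → y ∈ LinearMap.range (d 0) := by
    intro y hy
    have hy' := (h0 _).2 hy
    refine (h0 y).1 ?_
    obtain ⟨r, hr⟩ := Ideal.Quotient.mk_surjective (ε y)
    rw [map_smul, ← hr] at hy'
    rw [← hr]
    exact Ideal.Quotient.eq_zero_iff_mem.2 (hI r (Ideal.Quotient.eq_zero_iff_mem.1 hy'))
  have h0t := rTensor_exact (R ⧸ N) h0 hε
  have hregt : ∀ y, a • y ∈ LinearMap.range ((d 0).rTensor (R ⧸ N)) →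
      y ∈ LinearMap.range ((d 0).rTensor (R ⧸ N)) := by
    intro y hy
    have hy' := (h0t _).2 hy
    refine (h0t y).1 ?_
    let e := (quotientTensorQuotientSupEquiv I N).toLinearEquiv
    obtain ⟨r, hr⟩ := Ideal.Quotient.mk_surjective (e (ε.rTensor (R ⧸ N) y))
    rw [← e.map_eq_zero_iff, map_smul, map_smul, ← hr] at hy'
    rw [← e.map_eq_zero_iff, ← hr]
    exact Ideal.Quotient.eq_zero_iff_mem.2 (hIN r (Ideal.Quotient.eq_zero_iff_mem.1 hy'))
  let ε' : C 0 →ₗ[R] R ⧸ (I ⊔ Ideal.span {a}) :=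
    (Ideal.Quotient.factorₐ R le_sup_left).toLinearMap ∘ₗ ε
  refine ⟨fun n => match n with
    | 0 => C 0
    | n + 1 => ModuleCat.of R (C (n + 1) × C n), fun n => match n with
    | 0 => coneMapZero a (d 0)
    | n + 1 => coneMap a (d (n + 1)) (d n), ε', ?_, ?_, ?_, ?_, ?_⟩
  · rintro (_ | n)
    · exact hproj 0
    · have := hproj n
      have := hproj (n + 1)
      exact inferInstanceAs (Module.Projective R (C (n + 1) × C n))
  · exact (Ideal.Quotient.factor_surjective le_sup_left).comp hε
  · intro x
    constructor
    · intro hx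
      obtain ⟨r, hr⟩ := Ideal.Quotient.mk_surjective (ε x)
      change Ideal.Quotient.factor le_sup_left (ε x) = 0 at hx
      rw [← hr, Ideal.Quotient.factor_mk, Ideal.Quotient.eq_zero_iff_mem,
        IsRegularMod.mem_sup_span_singleton] at hx
      obtain ⟨g, hg⟩ := hx
      obtain ⟨y, hy⟩ := hε (Ideal.Quotient.mk I g)
      have h1 : ε (x - a • y) = 0 := by
        rw [map_sub, map_smul, hy, ← hr]
        exact Ideal.Quotient.eq_zero_iff_mem.2 hg
      obtain ⟨z, hz⟩ := (h0 _).1 h1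
      refine ⟨(z, y), ?_⟩
      rw [coneMapZero_apply, hz]
      simp
    · rintro ⟨⟨z, y⟩, rfl⟩
      rw [coneMapZero_apply, map_add, map_smul]
      obtain ⟨r, hr⟩ := Ideal.Quotient.mk_surjective (ε y)
      have h1 : ε' (d 0 z) = 0 := by
        rw [LinearMap.comp_apply, h0.apply_apply_eq_zero, map_zero]
      have h2 : a • ε' y = 0 := by
        change a • Ideal.Quotient.factor le_sup_left (ε y) = 0
        rw [← hr, Ideal.Quotient.factor_mk]
        exact Ideal.Quotient.eq_zero_iff_mem.2 (Ideal.mem_sup_right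
          (Ideal.mul_mem_right _ _ (Ideal.mem_span_singleton_self a)))
      rw [h1, h2, add_zero]
  · rintro (_ | n)
    · exact exact_coneMapZero (hd 0) hreg
    · exact exact_coneMap a (hd (n + 1)) (hd n)
  · rintro (_ | n)
    · exact (Function.Exact.iff_of_ladder_linearEquiv (rTensor_coneMap _ a _ _)
        (rTensor_coneMapZero _ a _)).1 (exact_coneMapZero (hdt 0) hregt)
    · exact (Function.Exact.iff_of_ladder_linearEquiv (rTensor_coneMap _ a _ _)
        (rTensor_coneMap _ a _ _)).1 (exact_coneMap a (hdt (n + 1)) (hdt n))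

/-- A sequence that is regular modulo `I` and modulo `I ⊔ N` preserves Tor-independence. -/
theorem HasTorAcyclicResolution.sup_span_list {N : Ideal R} : ∀ {l : List R} {I : Ideal R},
    HasTorAcyclicResolution I N → IsRegularMod I l → IsRegularMod (I ⊔ N) l →
      HasTorAcyclicResolution (I ⊔ Ideal.span {a | a ∈ l}) N
  | [], _, h, _, _ => by simpa using h
  | a :: l, I, h, h1, h2 => by
    have h3 := h2.2
    rw [sup_right_comm] at h3
    have := sup_span_list (h.sup_span_singleton h1.1 h2.1) h1.2 h3
    rw [sup_assoc, ← Ideal.span_union] at this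
    convert this using 3
    ext; simp

open CategoryTheory

/-- `Tor'` derives its first argument, so the given resolution of `R ⧸ I` computes it, and the
assumed exactness after tensoring is the vanishing of homology. -/
theorem HasTorAcyclicResolution.isZero_tor' {I N : Ideal R} (h : HasTorAcyclicResolution I N)
    (n : ℕ) : Limits.IsZero (((Tor' (ModuleCat.{u} R) (n + 1)).obj (ModuleCat.of R (R ⧸ I))).obj
      (ModuleCat.of R (R ⧸ N))) := by
  obtain ⟨C, d, ε, hproj, hε, h0, hd, hdt⟩ := h
  let K : ChainComplex (ModuleCat.{u} R) ℕ := ChainComplex.of C (fun n => ModuleCat.ofHom (d n))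
    (fun n => by
      ext x
      exact (hd n).apply_apply_eq_zero x)
  have hK : ∀ n, K.d (n + 1) n = ModuleCat.ofHom (d n) := fun n => ChainComplex.of_d (X := C) (d := fun n => ModuleCat.ofHom (d n)) n
  have hKex : ∀ n, K.ExactAt (n + 1) := by
    intro n
    rw [HomologicalComplex.exactAt_iff' _ (n + 1 + 1) (n + 1) n (by simp) (by simp),
      ShortComplex.ShortExact.moduleCat_exact_iff_function_exact]
    dsimp only [HomologicalComplex.sc', HomologicalComplex.shortComplexFunctor']
    rw [hK, hK]
    exact hd n
  let P : ProjectiveResolution (ModuleCat.of R (R ⧸ I)) :=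
    { complex := K
      projective := fun n => (IsProjective.iff_projective _).1 (hproj n)
      π := (ChainComplex.toSingle₀Equiv _ _).symm ⟨ModuleCat.ofHom ε, by
        rw [hK]
        ext x
        exact h0.apply_apply_eq_zero x⟩
      quasiIso := ⟨fun n => by
        cases n
        · rw [ChainComplex.quasiIsoAt₀_iff, ShortComplex.quasiIso_iff_of_zeros']
          · refine ⟨?_, (ModuleCat.epi_iff_surjective _).2 hε⟩
            rw [ShortComplex.ShortExact.moduleCat_exact_iff_function_exact]
            have h1 : Function.Exact (K.d 1 0).hom ε := by
              rw [hK 0]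
              exact h0
            exact h1
          all_goals rfl
        · rw [quasiIsoAt_iff_exactAt']
          · apply hKex
          · apply ChainComplex.exactAt_succ_single_obj⟩ }
  refine Limits.IsZero.of_iso ?_ (P.isoLeftDerivedObj
    ((MonoidalCategory.tensoringRight (ModuleCat.{u} R)).obj (ModuleCat.of R (R ⧸ N))) (n + 1))
  refine (HomologicalComplex.exactAt_iff_isZero_homology _ _).1 ?_
  rw [HomologicalComplex.exactAt_iff' _ (n + 1 + 1) (n + 1) n (by simp) (by simp),
      ShortComplex.ShortExact.moduleCat_exact_iff_function_exact]
  have h1 : Function.Exact ((K.d (n + 1 + 1) (n + 1)).hom.rTensor (R ⧸ N))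
      ((K.d (n + 1) n).hom.rTensor (R ⧸ N)) := by
    rw [hK, hK]
    exact hdt n
  exact h1

theorem isZero_tor'_of_eq_top {I N : Ideal R} (hN : N = ⊤) (n : ℕ) :
    Limits.IsZero (((Tor' (ModuleCat.{u} R) n).obj (ModuleCat.of R (R ⧸ I))).obj
      (ModuleCat.of R (R ⧸ N))) := by
  subst hN
  let P := ProjectiveResolution.of (ModuleCat.of R (R ⧸ I))
  refine Limits.IsZero.of_iso ?_ (P.isoLeftDerivedObj
    ((MonoidalCategory.tensoringRight (ModuleCat.{u} R)).obj (ModuleCat.of R (R ⧸ (⊤ : Ideal R)))) n)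
  refine (HomologicalComplex.exactAt_iff_isZero_homology _ _).1 ?_
  refine ShortComplex.exact_of_isZero_X₂ _ ?_
  have : Subsingleton (P.complex.X n ⊗[R] (R ⧸ (⊤ : Ideal R))) := inferInstance
  exact ModuleCat.isZero_of_subsingleton (ModuleCat.of R (P.complex.X n ⊗[R] (R ⧸ (⊤ : Ideal R))))

/-- `Tor` in degree zero of two cyclic modules. -/
noncomputable def tor'ZeroEquiv (I N : Ideal R) :
    (((Tor' (ModuleCat.{u} R) 0).obj (ModuleCat.of R (R ⧸ I))).obj
      (ModuleCat.of R (R ⧸ N))) ≃ₗ[R] R ⧸ (I ⊔ N) :=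
  (((MonoidalCategory.tensoringRight (ModuleCat.{u} R)).obj
    (ModuleCat.of R (R ⧸ N))).leftDerivedZeroIsoSelf.app (ModuleCat.of R (R ⧸ I))).toLinearEquiv ≪≫ₗ
      (quotientTensorQuotientSupEquiv I N).toLinearEquiv

end TorVanishing

/-! ### Comparison with the Floer relations. -/

theorem Ideal.span_range_eq_of_associated {R ι : Type*} [CommRing R] {f g : ι → R}
    (h : ∀ i, Associated (f i) (g i)) :
    Ideal.span (Set.range f) = Ideal.span (Set.range g) := by
  apply le_antisymm <;> refine Ideal.span_le.2 ?_ <;> rintro _ ⟨i, rfl⟩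
  · exact Ideal.mem_of_dvd _ (h i).symm.dvd (Ideal.subset_span ⟨i, rfl⟩)
  · exact Ideal.mem_of_dvd _ (h i).dvd (Ideal.subset_span ⟨i, rfl⟩)

namespace TrivalentGraph

open MvPolynomial

variable {G : TrivalentGraph} {𝕜 : Type*} [Field 𝕜]

theorem tpow_add (a b : ℤ) : tpow 𝕜 (a + b) = tpow 𝕜 a * tpow 𝕜 b := by
  simp [tpow, HahnSeries.single_mul_single]

theorem tpow_zero : tpow 𝕜 0 = 1 := rfl

theorem tpow_one_pow (n : ℕ) : tpow 𝕜 1 ^ n = tpow 𝕜 n := by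
  simp [tpow, HahnSeries.single_pow]

theorem isUnit_C_tpow (a : ℤ) : IsUnit (C (tpow 𝕜 a) : G.EdgeRing 𝕜) := by
  refine IsUnit.map C (IsUnit.of_mul_eq_one (tpow 𝕜 (-a)) ?_)
  rw [← tpow_add, add_neg_cancel, tpow_zero]

/-- Substituting `y = t⁻¹ x` leaves `t ^ (-|in|)` on the entering product; clearing this unit raises
the exponent of the other term from the number of internal edges to the Floer weight. -/
theorem N_eq_nonlocalSpan : G.N 𝕜 (fun _ => 1) = G.nonlocalSpan (tpow 𝕜 1) := by
  rw [N, nonlocalIdeal, Ideal.map_span, ← Set.range_comp, nonlocalSpan, eq_comm]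
  refine Ideal.span_range_eq_of_associated fun Γ => ?_
  obtain ⟨u, hu⟩ := isUnit_C_tpow (G := G) (𝕜 := 𝕜) (-((G.setIn Γ).card : ℤ))
  refine ⟨u, ?_⟩
  have hw : G.weight (fun _ => 1) Γ = ((G.internalEdges Γ).card : ℤ) := by simp [weight]
  have h1 : tpow 𝕜 1 ^ G.floerWeight Γ * tpow 𝕜 (-((G.setIn Γ).card : ℤ)) =
      tpow 𝕜 ((G.internalEdges Γ).card : ℤ) := by
    rw [tpow_one_pow, ← tpow_add, ← card_setIn_add_card_internalEdges]
    congr 1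
    push_cast
    ring
  have h2 : (C (tpow 𝕜 (-((G.setIn Γ).card : ℤ))) : G.EdgeRing 𝕜) =
      C (tpow 𝕜 (-1)) ^ (G.setIn Γ).card := by
    rw [← C_pow]
    congr 1
    simp [tpow, HahnSeries.single_pow]
  rw [hu, nonlocalGen, sub_mul, mul_right_comm, ← C_mul, h1]
  simp only [Function.comp_apply, toEdgeRing, x, y, map_sub, map_mul, map_prod, aeval_X,
    Sum.elim_inl, Sum.elim_inr, algHom_C, algebraMap_eq, Finset.prod_mul_distrib,
    Finset.prod_const, hw, h2]
  ring

theorem L_eq_span_linearGen :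
    G.L 𝕜 (fun _ => 1) =
      Ideal.span (Set.range fun v : {v : G.Node // G.isThick v = true} =>
        G.linearGen (tpow 𝕜 1) v.1) := by
  have hset : {p | ∃ v : G.Node, G.isThick v = true ∧
      p = (∑ e ∈ G.outEdges v, x 𝕜 e) - ∑ e ∈ G.inEdges v, y 𝕜 e} =
      Set.range fun v : {v : G.Node // G.isThick v = true} =>
        (∑ e ∈ G.outEdges v.1, x 𝕜 e) - ∑ e ∈ G.inEdges v.1, y 𝕜 e := by
    ext p
    constructor
    · rintro ⟨v, hv, rfl⟩
      exact ⟨⟨v, hv⟩, rfl⟩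
    · rintro ⟨⟨v, hv⟩, rfl⟩
      exact ⟨v, hv, rfl⟩
  rw [L, linearIdeal, hset, Ideal.map_span, ← Set.range_comp, eq_comm]
  refine Ideal.span_range_eq_of_associated fun v => ?_
  obtain ⟨u, hu⟩ := (isUnit_C_tpow (G := G) (𝕜 := 𝕜) (-1)).neg
  refine ⟨u, ?_⟩
  have h1 : tpow 𝕜 1 * tpow 𝕜 (-1) = 1 := by rw [← tpow_add, add_neg_cancel, tpow_zero]
  rw [hu, linearGen, sub_mul, mul_right_comm, mul_neg, mul_neg, ← C_mul, h1]
  simp only [Function.comp_apply, toEdgeRing, x, y, map_sub, map_sum, aeval_X,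
    Sum.elim_inl, Sum.elim_inr, ← Finset.mul_sum, C_1]
  ring

theorem prod_setOut_mul_prod_internalEdges {M : Type*} [CommMonoid M] (f : G.Edge → M)
    (v : G.Node) :
    ∏ e ∈ G.outEdges v, f e = (∏ e ∈ G.setOut {v}, f e) * ∏ e ∈ G.internalEdges {v}, f e := by
  have := sum_outEdges (fun e => Additive.ofMul (f e)) {v}
  rw [Finset.sum_singleton] at this
  exact this

theorem prod_setIn_mul_prod_internalEdges {M : Type*} [CommMonoid M] (f : G.Edge → M)
    (v : G.Node) :
    ∏ e ∈ G.inEdges v, f e = (∏ e ∈ G.setIn {v}, f e) * ∏ e ∈ G.internalEdges {v}, f e := by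
  have := sum_inEdges (fun e => Additive.ofMul (f e)) {v}
  rw [Finset.sum_singleton] at this
  exact this

/-- A loop at `v` occurs in both products here but is internal to `{v}`; it is a common factor, so
the local relation is a multiple of the non-local one. -/
theorem local_mem_nonlocalSpan (v : G.Node) :
    C (tpow 𝕜 (G.floerWeight {v})) * (∏ e ∈ G.outEdges v, X e) - ∏ e ∈ G.inEdges v, X e ∈
      G.nonlocalSpan (tpow 𝕜 1) := by
  rw [prod_setOut_mul_prod_internalEdges, prod_setIn_mul_prod_internalEdges, ← mul_assoc,
    ← sub_mul, ← tpow_one_pow]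
  exact Ideal.mul_mem_right _ _ (Ideal.subset_span ⟨{v}, rfl⟩)

theorem span_floerRelation :
    Ideal.span {p : G.EdgeRing 𝕜 | G.FloerRelation 𝕜 p} =
      G.L 𝕜 (fun _ => 1) ⊔ G.N 𝕜 (fun _ => 1) := by
  rw [L_eq_span_linearGen, N_eq_nonlocalSpan]
  apply le_antisymm
  · refine Ideal.span_le.2 ?_
    rintro _ (⟨v, hv⟩ | ⟨v, hv⟩ | ⟨v, hv⟩ | ⟨W⟩)
    · refine Ideal.mem_sup_left ?_
      rw [← neg_mem_iff, neg_sub]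
      exact Ideal.subset_span ⟨⟨v, hv⟩, rfl⟩
    · have := local_mem_nonlocalSpan (𝕜 := 𝕜) v
      rw [floerWeight_eq_sum, Finset.sum_singleton, card_inEdges, if_pos hv] at this
      exact Ideal.mem_sup_right this
    · have := local_mem_nonlocalSpan (𝕜 := 𝕜) v
      rw [floerWeight_eq_sum, Finset.sum_singleton, card_inEdges, if_neg (by simp [hv])] at this
      exact Ideal.mem_sup_right this
    · refine Ideal.mem_sup_right ?_
      rw [← tpow_one_pow]
      exact Ideal.subset_span ⟨W, rfl⟩
  · refine sup_le (Ideal.span_le.2 ?_) (Ideal.span_le.2 ?_)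
    · rintro _ ⟨v, rfl⟩
      rw [SetLike.mem_coe, ← neg_mem_iff]
      simp only [linearGen, neg_sub]
      exact Ideal.subset_span (FloerRelation.linear v.1 v.2)
    · rintro _ ⟨W, rfl⟩
      rw [nonlocalGen, tpow_one_pow]
      exact Ideal.subset_span (FloerRelation.nonlocal W)

/-- A connected component without incoming boundary edge makes the non-local ideal trivial. -/
theorem N_eq_top {c : G.Component} (hc : ∀ e, G.componentOf e = c → G.src e ≠ none) :
    G.N 𝕜 (fun _ => 1) = ⊤ := by
  classical
  set Γ : Finset G.Node := Finset.univ.filter fun v =>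
    ∃ e, G.componentOf e = c ∧ (G.src e = some v ∨ G.tgt e = some v)
  have hΓ : Γ.Nonempty := by
    obtain ⟨e, rfl⟩ := Quot.exists_rep c
    obtain ⟨v, hv⟩ := Option.ne_none_iff_exists'.1 (hc e rfl)
    exact ⟨v, Finset.mem_filter.2 ⟨Finset.mem_univ _, e, rfl, Or.inl hv⟩⟩
  have hin : G.setIn Γ = ∅ := by
    rw [Finset.eq_empty_iff_forall_notMem]
    intro f hf
    obtain ⟨h1, v, hv, ht⟩ := mem_setIn.1 hf
    obtain ⟨e, hec, he⟩ := (Finset.mem_filter.1 hv).2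
    have hfc : G.componentOf f = c := by
      rw [← hec]
      exact Quot.sound ⟨v, Or.inr ht, he⟩
    obtain ⟨u, hu⟩ := Option.ne_none_iff_exists'.1 (hc f hfc)
    exact h1 u (Finset.mem_filter.2 ⟨Finset.mem_univ _, f, hfc, Or.inl hu⟩) hu
  have hout : G.setOut Γ = ∅ := by
    rw [← Finset.card_eq_zero, card_setOut_eq, hin, Finset.card_empty]
  rw [N_eq_nonlocalSpan]
  refine Ideal.eq_top_of_isUnit_mem _ (x := G.nonlocalGen (tpow 𝕜 1) Γ)
    (Ideal.subset_span ⟨Γ, rfl⟩) ?_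
  -- The generator is the constant `t ^ w - 1` with `w > 0`, nonzero because its coefficient in
  -- degree 0 is not zero.
  rw [nonlocalGen, hin, hout, Finset.prod_empty, mul_one, ← C_1, ← C_sub]
  refine IsUnit.map C (IsUnit.mk0 _ (sub_ne_zero.2 fun h => ?_))
  rw [tpow_one_pow] at h
  have h1 := congrArg (fun s : LaurentSeries 𝕜 => s.coeff 0) h
  have h2 : (0 : ℤ) ≠ (G.floerWeight Γ : ℤ) := by exact_mod_cast (floerWeight_pos hΓ).ne
  simp [tpow, HahnSeries.coeff_single_of_ne h2] at h1

/-- On a connected graph with boundary the higher Tor modules of the all-one framing vanish. -/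
theorem subsingleton_torMod_succ {e₀ : G.Edge} (h₀ : G.src e₀ = none)
    (hconn : ∀ e, G.componentOf e = G.componentOf e₀) (i : ℕ) :
    Subsingleton (G.TorMod 𝕜 (fun _ => 1) (i + 1)) := by
  set s : Finset G.Node := Finset.univ.filter fun v => G.isThick v = true
  have hs : ∀ v ∈ s.toList, G.isThick v = true := by simp [s]
  have h1 := isRegularMod_bot_linearGen (𝕜 := 𝕜) s.nodup_toList hs
  have h2 := isRegularMod_nonlocalSpan_linearGen (𝕜 := 𝕜) h₀ hconn s.nodup_toList hs
  rw [← N_eq_nonlocalSpan, ← bot_sup_eq (G.N 𝕜 _)] at h2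
  have h3 := (hasTorAcyclicResolution_bot (G.N 𝕜 fun _ => 1)).sup_span_list h1 h2
  have h4 : (⊥ ⊔ Ideal.span {a | a ∈ s.toList.map (G.linearGen (tpow 𝕜 1))} :
      Ideal (G.EdgeRing 𝕜)) = G.L 𝕜 (fun _ => 1) := by
    rw [bot_sup_eq, L_eq_span_linearGen]
    congr 1
    ext p
    simp [s]
  rw [h4] at h3
  exact ModuleCat.subsingleton_of_isZero (h3.isZero_tor' i)

end TrivalentGraph

/-! ### Assembling the isomorphism. -/

theorem ExteriorAlgebra.algebraMap_bijective_of_subsingleton (R M : Type*) [CommRing R]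
    [AddCommGroup M] [Module R M] [Subsingleton M] :
    Function.Bijective (algebraMap R (ExteriorAlgebra R M)) := by
  refine ⟨(ExteriorAlgebra.algebraMap_leftInverse M).injective, fun p => ?_⟩
  induction p using ExteriorAlgebra.induction with
  | algebraMap r => exact ⟨r, rfl⟩
  | ι m => exact ⟨0, by rw [Subsingleton.elim m 0, map_zero, map_zero]⟩
  | mul p q hp hq =>
    obtain ⟨r, rfl⟩ := hp
    obtain ⟨s, rfl⟩ := hq
    exact ⟨r * s, map_mul _ _ _⟩
  | add p q hp hq =>
    obtain ⟨r, rfl⟩ := hp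
    obtain ⟨s, rfl⟩ := hq
    exact ⟨r + s, map_add _ _ _⟩

theorem DirectSum.component_zero_bijective {R : Type*} [CommRing R] (M : ℕ → Type*)
    [∀ i, AddCommGroup (M i)] [∀ i, Module R (M i)] (h : ∀ i, Subsingleton (M (i + 1))) :
    Function.Bijective (DirectSum.component R ℕ M 0) := by
  constructor
  · intro p q hpq
    refine DirectSum.ext_component R fun i => ?_
    cases i with
    | zero => exact hpq
    | succ i => exact (h i).elim _ _
  · exact fun m => ⟨DirectSum.lof R ℕ M 0 m, DirectSum.component.lof_self R 0 m⟩

namespace TrivalentGraph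

variable {G : TrivalentGraph} {𝕜 : Type*} [Field 𝕜] (special : Set G.Component)

/-- The graph homology of a connected graph with boundary, all of whose components are special. -/
theorem exists_equiv_of_connected {e₀ : G.Edge} (h₀ : G.src e₀ = none)
    (hconn : ∀ e, G.componentOf e = G.componentOf e₀) (hspecial : ∀ c, c ∈ special) :
    ∃ Φ : G.GraphHomology 𝕜 (fun _ => 1) special ≃ₗ[G.EdgeRing 𝕜] G.FloerGraphHomology 𝕜,
      ∀ (i j : ℕ) (a : G.TorMod 𝕜 (fun _ => 1) i)
        (ω : ExteriorAlgebra (G.EdgeRing 𝕜) (G.V 𝕜 special)),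
        ω ∈ ⋀[G.EdgeRing 𝕜]^j (G.V 𝕜 special) → (i, j) ≠ (0, 0) →
        Φ (TensorProduct.tmul (G.EdgeRing 𝕜)
          (DirectSum.lof (G.EdgeRing 𝕜) ℕ (fun i => G.TorMod 𝕜 (fun _ => 1) i) i a) ω) = 0 := by
  have hTor : ∀ i, Subsingleton (G.TorMod 𝕜 (fun _ => 1) (i + 1)) :=
    subsingleton_torMod_succ h₀ hconn
  have hempty : IsEmpty {c : G.Component // c ∉ special} := ⟨fun c => c.2 (hspecial c.1)⟩
  have hV : Subsingleton (G.V 𝕜 special) := inferInstance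
  let e₁ := LinearEquiv.ofBijective _ (DirectSum.component_zero_bijective
    (R := G.EdgeRing 𝕜) (fun i => G.TorMod 𝕜 (fun _ => 1) i) hTor)
  let e₂ := (LinearEquiv.ofBijective (Algebra.linearMap (G.EdgeRing 𝕜) _)
    (ExteriorAlgebra.algebraMap_bijective_of_subsingleton (G.EdgeRing 𝕜) (G.V 𝕜 special))).symm
  refine ⟨TensorProduct.congr e₁ e₂ ≪≫ₗ TensorProduct.rid _ _ ≪≫ₗ
    tor'ZeroEquiv (G.L 𝕜 fun _ => 1) (G.N 𝕜 fun _ => 1) ≪≫ₗ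
    (Ideal.quotientEquivAlgOfEq _ span_floerRelation.symm).toLinearEquiv, ?_⟩
  intro i j a ω hω hij
  cases i with
  | succ i => rw [(hTor i).elim a 0, map_zero, TensorProduct.zero_tmul, map_zero]
  | zero =>
    have hj : j ≠ 0 := fun h => hij (by rw [h])
    have hι : LinearMap.range (ExteriorAlgebra.ι (G.EdgeRing 𝕜) (M := G.V 𝕜 special)) = ⊥ := by
      rw [LinearMap.range_eq_bot]
      exact LinearMap.ext fun v => by rw [Subsingleton.elim v 0, map_zero, map_zero]
    change ω ∈ LinearMap.range (ExteriorAlgebra.ι (G.EdgeRing 𝕜)) ^ j at hω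
    rw [hι, Submodule.bot_pow hj, Submodule.mem_bot] at hω
    rw [hω, TensorProduct.tmul_zero, map_zero]

/-- When the non-local ideal is trivial both homologies vanish. -/
theorem subsingleton_of_N_eq_top (hN : G.N 𝕜 (fun _ => 1) = ⊤) :
    Subsingleton (G.GraphHomology 𝕜 (fun _ => 1) special) ∧
      Subsingleton (G.FloerGraphHomology 𝕜) := by
  have hTor : ∀ i, Subsingleton (G.TorMod 𝕜 (fun _ => 1) i) := fun i =>
    ModuleCat.subsingleton_of_isZero (isZero_tor'_of_eq_top hN i)
  have h : Subsingleton (DirectSum ℕ fun i => G.TorMod 𝕜 (fun _ => 1) i) :=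
    ⟨fun p q => DirectSum.ext_component (G.EdgeRing 𝕜) fun i => (hTor i).elim _ _⟩
  exact ⟨inferInstance, Ideal.Quotient.subsingleton_iff.2 (by
    rw [span_floerRelation, hN, sup_top_eq])⟩

end TrivalentGraph

theorem proposition2p3 {𝕜 : Type*} [Field 𝕜] {n m : ℕ} (w : Fin m → BraidLetter n)
    (hw : ∀ s : Fin (n + 1), ∃ k : Fin m, s ∈ (w k).strands) :
    ∃ Φ : (closedBraidGraph w).GraphHomology 𝕜 (fun _ => 1) (outermostSpecial w)
        ≃ₗ[(closedBraidGraph w).EdgeRing 𝕜] (closedBraidGraph w).FloerGraphHomology 𝕜,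
      ∀ (i j : ℕ) (a : (closedBraidGraph w).TorMod 𝕜 (fun _ => 1) i)
        (ω : ExteriorAlgebra ((closedBraidGraph w).EdgeRing 𝕜)
          ((closedBraidGraph w).V 𝕜 (outermostSpecial w))),
        ω ∈ ⋀[(closedBraidGraph w).EdgeRing 𝕜]^j
          ((closedBraidGraph w).V 𝕜 (outermostSpecial w)) →
        (i, j) ≠ (0, 0) →
        Φ (TensorProduct.tmul ((closedBraidGraph w).EdgeRing 𝕜)
          (DirectSum.lof ((closedBraidGraph w).EdgeRing 𝕜) ℕ
            (fun i => (closedBraidGraph w).TorMod 𝕜 (fun _ => 1) i) i a) ω) = 0 := by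
  -- Only the bottom of the cut strand is an edge without a source, so any other component meets the
  -- hypothesis of `N_eq_top`.
  have hsrc : ∀ e : (closedBraidGraph w).Edge, (closedBraidGraph w).src e = none →
      e = (none : BraidWord.Edge w) := by
    rintro (_ | p) h
    · rfl
    · cases h
  by_cases hconn : ∀ e, (closedBraidGraph w).componentOf e =
      (closedBraidGraph w).componentOf (none : BraidWord.Edge w)
  · refine TrivalentGraph.exists_equiv_of_connected _ (e₀ := (none : BraidWord.Edge w)) rfl hconn
      fun c => ?_
    obtain ⟨e, rfl⟩ := Quot.exists_rep c
    exact hconn e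
  · push Not at hconn
    obtain ⟨e, he⟩ := hconn
    have hN : (closedBraidGraph w).N 𝕜 (fun _ => 1) = ⊤ := by
      refine TrivalentGraph.N_eq_top (c := (closedBraidGraph w).componentOf e) fun f hf h => he ?_
      rw [← hf, hsrc f h]
    obtain ⟨h₁, h₂⟩ := TrivalentGraph.subsingleton_of_N_eq_top (outermostSpecial w) hN
    exact ⟨⟨0, 0, fun _ => h₁.elim _ _, fun _ => h₂.elim _ _⟩, fun _ _ _ _ _ _ => h₂.elim _ _⟩
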